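/- Let $R$ be a commutative Noetherian ring and let $\Gamma$ be a Noetherian $R$-algebra, i.e. an $R$-algebra that is finitely generated as an $R$-module. Let $M$ be a finitely generated $\Gamma$-bimodule on which $R$ acts centrally ($rx=xr$ for all $r\in R$, $x\in M$), and let $n\ge 1$ be an integer with $M^{\otimes_\Gamma n}=0$. Let $T_\Gamma(M)=\Gamma\oplus M\oplus (M\otimes_\Gamma M)\oplus\cdots$ be the tensor ring. Then $\Gamma$ and $T_\Gamma(M)$ are right Noetherian, so that the categories $\mathrm{mod}\,\Gamma$ and $\mathrm{mod}\,T_\Gamma(M)$ of finitely generated right modules are abelian with enough projectives, and the following hold (in $\mathbb N\cup\{\infty\}$). (1) If ${}_\Gamma M$ and $M_\Gamma$ are projective, then $$\mathrm{IT}(\Gamma)\le \mathrm{IT}(T_\Gamma(M))\le n(\mathrm{IT}(\Gamma)+1)-1$$ and $$\dim(\Gamma)\le\dim(T_\Gamma(M))\le n(\dim(\Gamma)+1)-1 .$$ (2) If $M$ is left perfect, i.e. $M$ has finite projective dimension as a left $\Gamma$-module and $\mathrm{Tor}_i^\Gamma(M,M^{\otimes j})=0$ for all $i,j\ge 1$,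 then $$\mathrm{der.dim}\,D^b(\mathrm{mod}\,\Gamma)\le \mathrm{der.dim}\,D^b(\mathrm{mod}\,T_\Gamma(M))\le n(\mathrm{der.dim}\,D^b(\mathrm{mod}\,\Gamma)+1)-1 .$$ Here, for an object or class of objects $U$ of an additive category, $\mathrm{add}(U)$ consists of the direct summands of finite direct sums of objects of $U$, and: - $\mathrm{IT}(\Lambda)$, the Igusa–Todorov distance of $\mathscr A=\mathrm{mod}\,\Lambda$, is the infimum of the $m\ge 0$ for which there are $t\ge 0$ and $U\in\mathscr A$ such that every $A\in\mathscr A$ admits an exact sequence $0\to U_m\to\cdots\to U_0\to\Omega^t(A)\to 0$ with all $U_i\in\mathrm{add}(U)$, where $\Omega^t(A)$ is a $t$-th syzygy of $A$. - $\dim(\Lambda)$, the extension dimension of $\mathscr A=\mathrm{mod}\,\Lambda$, is the infimum of the $m\ge 0$ with $\mathscr A=[T]_{m+1}$ for some $T\in\mathscr A$, where $[T]_1=\mathrm{add}(T)$ and $[T]_{k}=\mathrm{add}$ of the class of all $A$ with an exact sequence $0\to X\to A\to Y\to 0$, $X\in[T]_1$, $Y\in[T]_{k-1}$, for $k\ge2$.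 - $\mathrm{der.dim}\,\mathscr T$, the Rouquier dimension of a triangulated category $\mathscr T$, is the infimum of the $m\ge 0$ with $\mathscr T=\langle G\rangle_{m+1}$ for some $G\in\mathscr T$, where $\langle\mathcal U\rangle_1$ is the smallest full subcategory containing $\mathcal U$ and closed under finite direct sums, direct summands and shifts, and $\langle G\rangle_{k+1}=\langle \mathcal C\rangle_1$ with $\mathcal C$ the class of all $A$ in a triangle $X\to A\to Y\to X[1]$, $X\in\langle G\rangle_1$, $Y\in\langle G\rangle_k$. -/

import Mathlib

open CategoryTheory CategoryTheory.Limits CategoryTheory.Pretriangulated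
open scoped TensorProduct MulOpposite ZeroObject

/-! ## Igusa-Todorov distance and extension dimension of an abelian category -/

section AbelianCategory

universe v u

attribute [local instance] Abelian.hasFiniteBiproducts

variable {C : Type u} [Category.{v} C] [Abelian C]

/-- `add P`: the direct summands of finite direct sums of objects satisfying `P`. -/
def addClosure (P : ObjectProperty C) : ObjectProperty C := fun X =>
  ∃ (k : ℕ) (f : Fin k → C), (∀ i, P (f i)) ∧ Nonempty (Retract X (⨁ f))

/-- `K` is an `n`-th syzygy of `A`: a zeroth syzygy of `A` is (a copy of) `A` itself, and an
`(n+1)`-st syzygy is the kernel of an epimorphism from a projective object onto an `n`-th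
syzygy. -/
def IsSyzygy : ℕ → C → C → Prop
  | 0, A, K => Nonempty (K ≅ A)
  | n + 1, A, K => ∃ (L P : C) (i : K ⟶ P) (p : P ⟶ L) (w : i ≫ p = 0),
      IsSyzygy n A L ∧ Projective P ∧ (ShortComplex.mk i p w).ShortExact

/-- There is an exact sequence `0 ⟶ U_m ⟶ ⋯ ⟶ U_1 ⟶ U_0 ⟶ A ⟶ 0` with all `U_i` in `add U`,
presented as a splice of short exact sequences `0 ⟶ K ⟶ U_0 ⟶ A ⟶ 0`,
`0 ⟶ K' ⟶ U_1 ⟶ K ⟶ 0`, and so on. -/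
def HasAddResolution (U : C) : ℕ → C → Prop
  | 0, A => addClosure (fun X => X = U) A
  | m + 1, A => ∃ (K U₀ : C) (i : K ⟶ U₀) (p : U₀ ⟶ A) (w : i ≫ p = 0),
      addClosure (fun X => X = U) U₀ ∧ (ShortComplex.mk i p w).ShortExact ∧
        HasAddResolution U m K

variable (C) in
/-- `C` is an `(m, n)`-Igusa-Todorov category. By Schanuel's lemma, after enlarging `U` by the
projectives involved, it does not matter which `n`-th syzygy of `A` is taken. -/
def IsIgusaTodorov (m n : ℕ) : Prop :=
  ∃ U : C, ∀ A : C, ∃ K : C, IsSyzygy n A K ∧ HasAddResolution U m K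

variable (C) in
/-- The Igusa-Todorov distance of `C` (it is `⊤` if `C` is `(m, n)`-Igusa-Todorov for no
`m`, `n`). -/
noncomputable def igusaTodorovDistance : ℕ∞ :=
  ⨅ (m : ℕ) (_ : ∃ n : ℕ, IsIgusaTodorov C m n), (m : ℕ∞)

/-- `P • Q`: the direct summands of finite direct sums of extensions `0 ⟶ X ⟶ A ⟶ Y ⟶ 0` with
`X` in `P` and `Y` in `Q`. -/
def extensionProduct (P Q : ObjectProperty C) : ObjectProperty C :=
  addClosure fun A => ∃ (X Y : C) (i : X ⟶ A) (p : A ⟶ Y) (w : i ≫ p = 0),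
    P X ∧ Q Y ∧ (ShortComplex.mk i p w).ShortExact

/-- `[P]_n`: `[P]_0 = 0`, `[P]_1 = add P`, and `[P]_n = [P]_1 • [P]_{n-1}` for `n ≥ 2`. -/
def extensionPower (P : ObjectProperty C) : ℕ → ObjectProperty C
  | 0 => fun X => IsZero X
  | 1 => addClosure P
  | n + 2 => extensionProduct (addClosure P) (extensionPower P (n + 1))

variable (C) in
/-- The extension dimension of `C` (it is `⊤` if no `[T]_{n+1}` is the whole of `C`). -/
noncomputable def extensionDimension : ℕ∞ :=
  ⨅ (n : ℕ) (_ : ∃ T : C, ∀ A : C, extensionPower (fun X => X = T) (n + 1) A), (n : ℕ∞)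

end AbelianCategory

/-! ## Rouquier dimension of a triangulated category -/

section TriangulatedCategory

universe v u

variable {T : Type u} [Category.{v} T] [HasZeroObject T] [HasShift T ℤ] [Preadditive T]
  [∀ n : ℤ, (shiftFunctor T n).Additive] [Pretriangulated T]

/-- `⟨P⟩_1`: the smallest full subcategory which contains `P` and is closed under finite direct
sums, direct summands (in particular, isomorphisms) and shifts. -/
inductive thickOne (P : ObjectProperty T) : T → Prop
  | of (X : T) (hX : P X) : thickOne P X
  | zero (X : T) (hX : IsZero X) : thickOne P X
  | directSum (X Y S : T) (inl : X ⟶ S) (fst : S ⟶ X) (inr : Y ⟶ S) (snd : S ⟶ Y)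
      (h₁ : inl ≫ fst = 𝟙 X) (h₂ : inr ≫ snd = 𝟙 Y) (h : fst ≫ inl + snd ≫ inr = 𝟙 S)
      (hX : thickOne P X) (hY : thickOne P Y) : thickOne P S
  | summand (X Y : T) (r : Retract X Y) (hY : thickOne P Y) : thickOne P X
  | shift (X : T) (n : ℤ) (hX : thickOne P X) : thickOne P (X⟦n⟧)

/-- `P * Q`: the objects `A` in a distinguished triangle `X ⟶ A ⟶ Y ⟶ X⟦1⟧` with `X` in `P` and
`Y` in `Q`. -/
def triangleProduct (P Q : ObjectProperty T) : ObjectProperty T := fun A =>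
  ∃ (X Y : T) (f : X ⟶ A) (g : A ⟶ Y) (h : Y ⟶ X⟦(1 : ℤ)⟧),
    P X ∧ Q Y ∧ Triangle.mk f g h ∈ distTriang T

/-- `⟨P⟩_n`: `⟨P⟩_0 = 0` and `⟨P⟩_{n+1} = ⟨P⟩_1 ⋄ ⟨P⟩_n = ⟨⟨P⟩_1 * ⟨P⟩_n⟩_1`. -/
def thickPower (P : ObjectProperty T) : ℕ → ObjectProperty T
  | 0 => fun X => IsZero X
  | n + 1 => thickOne (triangleProduct (thickOne P) (thickPower P n))

variable (T) in
/-- The dimension of a triangulated category (it is `⊤` if no `⟨G⟩_{n+1}` is the whole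
category). -/
noncomputable def rouquierDimension : ℕ∞ :=
  ⨅ (n : ℕ) (_ : ∃ G : T, ∀ A : T, thickPower (fun X => X = G) (n + 1) A), (n : ℕ∞)

end TriangulatedCategory

/-! ## The invariants of a right Noetherian ring

Right `A`-modules are left modules over the opposite ring, so `FGModuleCat Aᵐᵒᵖ` is the category
`mod A` of finitely generated right `A`-modules. -/

section RingInvariants

universe u

variable (A : Type u) [Ring A] [IsNoetherianRing Aᵐᵒᵖ]

/-- `IT(A)`, the Igusa-Todorov distance of `mod A`. -/
noncomputable def ringIT : ℕ∞ := igusaTodorovDistance (FGModuleCat.{u} Aᵐᵒᵖ)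

/-- `dim A`, the extension dimension of `mod A`. -/
noncomputable def ringExtDim : ℕ∞ := extensionDimension (FGModuleCat.{u} Aᵐᵒᵖ)

/-- The Rouquier dimension of the bounded derived category of `mod A`. -/
noncomputable def ringDerDim : ℕ∞ :=
  letI := HasDerivedCategory.standard (FGModuleCat.{u} Aᵐᵒᵖ)
  rouquierDimension (DerivedCategory.Bounded (FGModuleCat.{u} Aᵐᵒᵖ))

end RingInvariants

/-! ## Tensor products over a noncommutative ring -/

section BalancedTensor

universe u

variable (A : Type u) [Ring A]

section

variable (X Y : Type u) [AddCommGroup X] [AddCommGroup Y] [Module Aᵐᵒᵖ X] [Module A Y]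

/-- The relations `(x a) ⊗ y = x ⊗ (a y)`. -/
def balancedRelations : AddSubgroup (X ⊗[ℤ] Y) :=
  AddSubgroup.closure {t | ∃ (x : X) (a : A) (y : Y),
    t = (MulOpposite.op a • x) ⊗ₜ[ℤ] y - x ⊗ₜ[ℤ] (a • y)}

/-- The tensor product `X ⊗_A Y` of a right `A`-module and a left `A`-module. -/
def BalancedTensor : Type u := (X ⊗[ℤ] Y) ⧸ balancedRelations A X Y

noncomputable instance : AddCommGroup (BalancedTensor A X Y) :=
  inferInstanceAs (AddCommGroup ((X ⊗[ℤ] Y) ⧸ balancedRelations A X Y))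

end

namespace BalancedTensor

variable {X Y X' Y' X'' Y'' : Type u}
  [AddCommGroup X] [AddCommGroup Y] [Module Aᵐᵒᵖ X] [Module A Y]
  [AddCommGroup X'] [AddCommGroup Y'] [Module Aᵐᵒᵖ X'] [Module A Y']
  [AddCommGroup X''] [AddCommGroup Y''] [Module Aᵐᵒᵖ X''] [Module A Y'']

/-- The elementary tensor `x ⊗ y`. -/
noncomputable def tmul (x : X) (y : Y) : BalancedTensor A X Y :=
  QuotientAddGroup.mk' (balancedRelations A X Y) (x ⊗ₜ[ℤ] y)

variable {A}

theorem induction_on {p : BalancedTensor A X Y → Prop} (t : BalancedTensor A X Y)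
    (zero : p 0) (tmul : ∀ x y, p (tmul A x y)) (add : ∀ s t, p s → p t → p (s + t)) : p t := by
  obtain ⟨t, rfl⟩ := QuotientAddGroup.mk'_surjective _ t
  induction t using TensorProduct.induction_on with
  | zero => exact zero
  | tmul x y => exact tmul x y
  | add s t hs ht => exact add _ _ hs ht

theorem hom_ext {Z : Type u} [AddCommGroup Z] {f g : BalancedTensor A X Y →+ Z}
    (h : ∀ x y, f (tmul A x y) = g (tmul A x y)) : f = g := by
  ext t
  induction t using induction_on with
  | zero => simp
  | tmul x y => exact h x y
  | add s t hs ht => simp [hs, ht]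

/-- The map `f ⊗ g`. -/
noncomputable def map (f : X →ₗ[Aᵐᵒᵖ] X') (g : Y →ₗ[A] Y') :
    BalancedTensor A X Y →+ BalancedTensor A X' Y' :=
  QuotientAddGroup.map (balancedRelations A X Y) (balancedRelations A X' Y')
    (TensorProduct.map f.toAddMonoidHom.toIntLinearMap
      g.toAddMonoidHom.toIntLinearMap).toAddMonoidHom (by
        refine (AddSubgroup.closure_le _).2 ?_
        rintro _ ⟨x, a, y, rfl⟩
        refine AddSubgroup.subset_closure ⟨f x, a, g y, ?_⟩
        simp)

@[simp] theorem map_tmul (f : X →ₗ[Aᵐᵒᵖ] X') (g : Y →ₗ[A] Y') (x : X) (y : Y) :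
    map f g (tmul A x y) = tmul A (f x) (g y) := rfl

theorem add_tmul (x x' : X) (y : Y) : tmul A (x + x') y = tmul A x y + tmul A x' y :=
  congrArg (QuotientAddGroup.mk' (balancedRelations A X Y)) (TensorProduct.add_tmul x x' y)

theorem tmul_add (x : X) (y y' : Y) : tmul A x (y + y') = tmul A x y + tmul A x y' :=
  congrArg (QuotientAddGroup.mk' (balancedRelations A X Y)) (TensorProduct.tmul_add x y y')

theorem zero_tmul (y : Y) : tmul A (0 : X) y = 0 :=
  congrArg (QuotientAddGroup.mk' (balancedRelations A X Y)) (TensorProduct.zero_tmul X y)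

theorem tmul_zero (x : X) : tmul A x (0 : Y) = 0 :=
  congrArg (QuotientAddGroup.mk' (balancedRelations A X Y)) (TensorProduct.tmul_zero Y x)

/-- The left action `a (x ⊗ y) = (a x) ⊗ y`, for a bimodule `X`. -/
noncomputable instance leftModule [Module A X] [SMulCommClass A Aᵐᵒᵖ X] :
    Module A (BalancedTensor A X Y) where
  smul a t := map (DistribSMul.toLinearMap Aᵐᵒᵖ X a) LinearMap.id t
  one_smul t := DFunLike.congr_fun (f := map (DistribSMul.toLinearMap Aᵐᵒᵖ X (1 : A))
    (LinearMap.id (R := A) (M := Y))) (g := AddMonoidHom.id _) (hom_ext (by simp)) t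
  mul_smul a b t := DFunLike.congr_fun (f := map (DistribSMul.toLinearMap Aᵐᵒᵖ X (a * b))
    (LinearMap.id (R := A) (M := Y)))
    (g := (map (DistribSMul.toLinearMap Aᵐᵒᵖ X a) LinearMap.id).comp
      (map (DistribSMul.toLinearMap Aᵐᵒᵖ X b) LinearMap.id))
    (hom_ext (by simp [mul_smul])) t
  smul_zero a := map_zero _
  smul_add a := map_add _
  add_smul a b t := DFunLike.congr_fun (f := map (DistribSMul.toLinearMap Aᵐᵒᵖ X (a + b))
    (LinearMap.id (R := A) (M := Y)))
    (g := map (DistribSMul.toLinearMap Aᵐᵒᵖ X a) LinearMap.id +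
      map (DistribSMul.toLinearMap Aᵐᵒᵖ X b) LinearMap.id)
    (hom_ext (by simp [add_smul, add_tmul])) t
  zero_smul t := DFunLike.congr_fun (f := map (DistribSMul.toLinearMap Aᵐᵒᵖ X (0 : A))
    (LinearMap.id (R := A) (M := Y))) (g := 0) (hom_ext (by simp [zero_tmul])) t

/-- The right action `(x ⊗ y) a = x ⊗ (y a)`, for a bimodule `Y`. -/
noncomputable instance rightModule [Module Aᵐᵒᵖ Y] [SMulCommClass A Aᵐᵒᵖ Y] :
    Module Aᵐᵒᵖ (BalancedTensor A X Y) :=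
  haveI : SMulCommClass Aᵐᵒᵖ A Y := SMulCommClass.symm _ _ _
  { smul a t := map LinearMap.id (DistribSMul.toLinearMap A Y a) t
    one_smul t := DFunLike.congr_fun (f := map (LinearMap.id (R := Aᵐᵒᵖ) (M := X))
      (DistribSMul.toLinearMap A Y (1 : Aᵐᵒᵖ))) (g := AddMonoidHom.id _) (hom_ext (by simp)) t
    mul_smul a b t := DFunLike.congr_fun (f := map (LinearMap.id (R := Aᵐᵒᵖ) (M := X))
      (DistribSMul.toLinearMap A Y (a * b)))
      (g := (map LinearMap.id (DistribSMul.toLinearMap A Y a)).comp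
        (map LinearMap.id (DistribSMul.toLinearMap A Y b)))
      (hom_ext (by simp [mul_smul])) t
    smul_zero a := map_zero _
    smul_add a := map_add _
    add_smul a b t := DFunLike.congr_fun (f := map (LinearMap.id (R := Aᵐᵒᵖ) (M := X))
      (DistribSMul.toLinearMap A Y (a + b)))
      (g := map LinearMap.id (DistribSMul.toLinearMap A Y a) +
        map LinearMap.id (DistribSMul.toLinearMap A Y b))
      (hom_ext (by simp [add_smul, tmul_add])) t
    zero_smul t := DFunLike.congr_fun (f := map (LinearMap.id (R := Aᵐᵒᵖ) (M := X))
      (DistribSMul.toLinearMap A Y (0 : Aᵐᵒᵖ))) (g := 0) (hom_ext (by simp [tmul_zero])) t }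

@[simp] theorem smul_tmul [Module A X] [SMulCommClass A Aᵐᵒᵖ X] (a : A) (x : X) (y : Y) :
    a • tmul A x y = tmul A (a • x) y := rfl

@[simp] theorem op_smul_tmul [Module Aᵐᵒᵖ Y] [SMulCommClass A Aᵐᵒᵖ Y] (a : Aᵐᵒᵖ) (x : X) (y : Y) :
    a • tmul A x y = tmul A x (a • y) := rfl

instance [Module A X] [SMulCommClass A Aᵐᵒᵖ X] [Module Aᵐᵒᵖ Y] [SMulCommClass A Aᵐᵒᵖ Y] :
    SMulCommClass A Aᵐᵒᵖ (BalancedTensor A X Y) where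
  smul_comm a b t := by
    induction t using induction_on with
    | zero => simp only [smul_zero]
    | tmul x y => rfl
    | add s t hs ht => simp only [smul_add, hs, ht]

end BalancedTensor

/-- The functor `X ⊗_A -` from left `A`-modules to abelian groups, for a right `A`-module `X`. -/
noncomputable def balancedTensorFunctor (X : Type u) [AddCommGroup X] [Module Aᵐᵒᵖ X] :
    ModuleCat.{u} A ⥤ AddCommGrpCat.{u} where
  obj Y := AddCommGrpCat.of (BalancedTensor A X Y)
  map f := AddCommGrpCat.ofHom (BalancedTensor.map LinearMap.id f.hom)
  map_id Y := by
    refine AddCommGrpCat.hom_ext (BalancedTensor.hom_ext fun x y => rfl)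
  map_comp f g := by
    refine AddCommGrpCat.hom_ext (BalancedTensor.hom_ext fun x y => rfl)

instance (X : Type u) [AddCommGroup X] [Module Aᵐᵒᵖ X] :
    (balancedTensorFunctor A X).Additive where
  map_add {_ _ f g} := AddCommGrpCat.hom_ext (BalancedTensor.hom_ext fun x y =>
    BalancedTensor.tmul_add x (f.hom y) (g.hom y))

/-- `Tor_i^A(X, Y)` for a right `A`-module `X` and a left `A`-module `Y`: the `i`-th left derived
functor of `X ⊗_A -`, evaluated at `Y`. -/
noncomputable def balancedTor (i : ℕ) (X Y : Type u) [AddCommGroup X] [Module Aᵐᵒᵖ X]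
    [AddCommGroup Y] [Module A Y] : AddCommGrpCat.{u} :=
  ((balancedTensorFunctor A X).leftDerived i).obj (ModuleCat.of A Y)

/-- An `A`-bimodule. -/
structure RingBimodule where
  carrier : Type u
  [addCommGroup : AddCommGroup carrier]
  [left : Module A carrier]
  [right : Module Aᵐᵒᵖ carrier]
  [comm : SMulCommClass A Aᵐᵒᵖ carrier]

attribute [instance] RingBimodule.addCommGroup RingBimodule.left RingBimodule.right
  RingBimodule.comm

end BalancedTensor

/-! ## Tensor powers of a bimodule, left perfect bimodules and the tensor ring -/

section TensorRing

universe u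

variable (A M : Type u) [Ring A] [AddCommGroup M] [Module A M] [Module Aᵐᵒᵖ M]
  [SMulCommClass A Aᵐᵒᵖ M]

/-- The tensor power `M ⊗_A ⋯ ⊗_A M`, as an `A`-bimodule: it is `A` for `n = 0`, and the
`(n+1)`-st power is the `n`-th power tensored with `M`. -/
noncomputable def bimodulePowerAux : ℕ → RingBimodule.{u} A
  | 0 => ⟨A⟩
  | n + 1 => ⟨BalancedTensor A (bimodulePowerAux n).carrier M⟩

/-- The tensor power `M ⊗_A ⋯ ⊗_A M` (`n` factors). -/
abbrev BimodulePower (n : ℕ) : Type u := (bimodulePowerAux A M n).carrier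

/-- The bimodule `M` is left perfect: it has finite projective dimension as a left `A`-module, and
`Tor_i^A(M, M^{⊗j}) = 0` for all `i, j ≥ 1`. -/
def IsLeftPerfect : Prop :=
  (∃ d : ℕ, HasProjectiveDimensionLE (ModuleCat.of A M) d) ∧
    ∀ i j : ℕ, 1 ≤ i → 1 ≤ j → IsZero (balancedTor A i M (BimodulePower A M j))

/-- The defining relations of the tensor ring: the generators coming from `A` form a copy of the
ring `A`, and the generators coming from `M` depend on `M` additively and in a way compatible with
the two actions of `A`. -/
inductive TensorRingRel : FreeAlgebra ℤ (A ⊕ M) → FreeAlgebra ℤ (A ⊕ M) → Prop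
  | one : TensorRingRel (FreeAlgebra.ι ℤ (Sum.inl 1)) 1
  | add (a b : A) : TensorRingRel (FreeAlgebra.ι ℤ (Sum.inl (a + b)))
      (FreeAlgebra.ι ℤ (Sum.inl a) + FreeAlgebra.ι ℤ (Sum.inl b))
  | mul (a b : A) : TensorRingRel (FreeAlgebra.ι ℤ (Sum.inl (a * b)))
      (FreeAlgebra.ι ℤ (Sum.inl a) * FreeAlgebra.ι ℤ (Sum.inl b))
  | add_right (x y : M) : TensorRingRel (FreeAlgebra.ι ℤ (Sum.inr (x + y)))
      (FreeAlgebra.ι ℤ (Sum.inr x) + FreeAlgebra.ι ℤ (Sum.inr y))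
  | left_smul (a : A) (x : M) : TensorRingRel (FreeAlgebra.ι ℤ (Sum.inr (a • x)))
      (FreeAlgebra.ι ℤ (Sum.inl a) * FreeAlgebra.ι ℤ (Sum.inr x))
  | right_smul (a : A) (x : M) :
      TensorRingRel (FreeAlgebra.ι ℤ (Sum.inr (MulOpposite.op a • x)))
        (FreeAlgebra.ι ℤ (Sum.inr x) * FreeAlgebra.ι ℤ (Sum.inl a))

/-- The tensor ring `T_A(M) = A ⊕ M ⊕ (M ⊗_A M) ⊕ ⋯`, as the ring generated by the ring `A` and
the `A`-bimodule `M`. -/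
def TensorRing : Type u := RingQuot (TensorRingRel A M)

noncomputable instance : Ring (TensorRing A M) :=
  inferInstanceAs (Ring (RingQuot (TensorRingRel A M)))

end TensorRing

universe u w

/-! ### Closure under finite sums and direct summands. -/

section AddClosure

universe v v' u'

attribute [local instance] Abelian.hasFiniteBiproducts

variable {C : Type u} [Category.{v} C] [Abelian C] {D : Type u'} [Category.{v'} D] [Abelian D]

/-! Write `T` for the tensor ring, `π : T → Γ` for the augmentation, `ι : Γ → T` for the inclusion
and `I = ker π`. Two features of this split extension carry the proof: `π ∘ ι = id`, and `I ^ n =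
0`, because `I ^ n` lives in tensor degrees at least `n`, where the powers of `M` vanish.

Lower bounds: restriction along `ι` is exact and, having restriction along `π` as a section,
essentially surjective. Such a functor carries generators, extensions and triangles over `T` to
those over `Γ`. It carries syzygies to syzygies as soon as `T` is projective as a right `Γ`-module.

Upper bounds: a right `T`-module `X` has the filtration `X ⊇ XI ⊇ ⋯ ⊇ XIⁿ = 0`, whose `n` layers are
`Γ`-modules restricted along `π`. If `m + 1` steps build every `Γ`-module, then `n(m + 1)` steps
build `X`; invariants count one less than the steps. For the derived category the same filtration is
taken degreewise on strictly bounded complexes, and short exact sequences of complexes give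
triangles.

For the Igusa-Todorov distance, restriction along `π` need not preserve projectives, but `0 → I → T
→ Γ → 0` with `I` projective over `T` shows that it raises projective dimension to at most one, so
one extra syzygy repairs this (`isSyzygy_succ_map`). The horseshoe lemma then glues the syzygies of
the layers, and `hasAddResolution_of_shortExactSeq` glues resolutions of lengths `a` and `b` into
one of length `a + b + 1`, provided one fixed object resolves enough further syzygies of the
quotient.

The projectivity of `T` over `Γ` and of `I` over `T` both come from a dual basis of `M` as a right
module. The assembly for abstract rings is `dimensions_of_split_extension`. Right modules appear as
left modules over opposite rings. -/

theorem addClosure_of_finite {P : ObjectProperty C} {ι : Type} [Finite ι] {X : C} (f : ι → C)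
    (hf : ∀ i, P (f i)) (r : Retract X (⨁ f)) : addClosure P X := by
  obtain ⟨k, ⟨e⟩⟩ := Finite.exists_equiv_fin ι
  exact ⟨k, f ∘ e.symm, fun i => hf _, ⟨r.trans (Retract.ofIso (biproduct.reindex e.symm f).symm)⟩⟩

theorem addClosure_of {P : ObjectProperty C} {X : C} (h : P X) : addClosure P X :=
  addClosure_of_finite (fun _ : Unit => X) (fun _ => h)
    ⟨biproduct.ι (fun _ : Unit => X) (), biproduct.π (fun _ : Unit => X) (), by simp⟩

theorem addClosure_retract {P : ObjectProperty C} {X Y : C} (r : Retract X Y)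
    (h : addClosure P Y) : addClosure P X := by
  obtain ⟨k, f, hf, ⟨s⟩⟩ := h
  exact ⟨k, f, hf, ⟨r.trans s⟩⟩

theorem addClosure_iso {P : ObjectProperty C} {X Y : C} (e : X ≅ Y)
    (h : addClosure P Y) : addClosure P X :=
  addClosure_retract (Retract.ofIso e) h

theorem addClosure_zero {P : ObjectProperty C} {X : C} (h : IsZero X) : addClosure P X :=
  addClosure_of_finite (fun i : Empty => i.elim) (fun i => i.elim) ⟨0, 0, h.eq_of_src _ _⟩

/-- A family indexed by a sum type has as biproduct the sum of the two partial biproducts. -/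
theorem exists_retract_biproduct_sum {ι κ : Type} [Finite ι] [Finite κ] (f : ι ⊕ κ → C) {X Y : C}
    (r : Retract X (⨁ fun i => f (Sum.inl i))) (s : Retract Y (⨁ fun i => f (Sum.inr i))) :
    Nonempty (Retract (X ⊞ Y) (⨁ f)) := by
  have h₁ : (biproduct.desc fun i => biproduct.ι f (Sum.inl i)) ≫
      (biproduct.lift fun i => biproduct.π f (Sum.inl i)) = 𝟙 _ := by
    refine biproduct.hom_ext _ _ fun i => biproduct.hom_ext' _ _ fun j => ?_
    rw [Category.assoc, biproduct.ι_desc_assoc, biproduct.lift_π]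
    by_cases h : j = i
    · subst h
      rw [Category.id_comp, biproduct.ι_π_self, biproduct.ι_π_self]
    · rw [Category.id_comp, biproduct.ι_π_ne _ h, biproduct.ι_π_ne _ (by simpa using h)]
  have h₂ : (biproduct.desc fun i => biproduct.ι f (Sum.inr i)) ≫
      (biproduct.lift fun i => biproduct.π f (Sum.inr i)) = 𝟙 _ := by
    refine biproduct.hom_ext _ _ fun i => biproduct.hom_ext' _ _ fun j => ?_
    rw [Category.assoc, biproduct.ι_desc_assoc, biproduct.lift_π]
    by_cases h : j = i
    · subst h
      rw [Category.id_comp, biproduct.ι_π_self, biproduct.ι_π_self]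
    · rw [Category.id_comp, biproduct.ι_π_ne _ h, biproduct.ι_π_ne _ (by simpa using h)]
  have h₃ : (biproduct.desc fun i => biproduct.ι f (Sum.inl i)) ≫
      (biproduct.lift fun i => biproduct.π f (Sum.inr i)) = 0 := by
    refine biproduct.hom_ext _ _ fun i => biproduct.hom_ext' _ _ fun j => ?_
    rw [Category.assoc, biproduct.ι_desc_assoc, biproduct.lift_π]
    rw [biproduct.ι_π_ne _ (by simp), zero_comp, comp_zero]
  have h₄ : (biproduct.desc fun i => biproduct.ι f (Sum.inr i)) ≫
      (biproduct.lift fun i => biproduct.π f (Sum.inl i)) = 0 := by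
    refine biproduct.hom_ext _ _ fun i => biproduct.hom_ext' _ _ fun j => ?_
    rw [Category.assoc, biproduct.ι_desc_assoc, biproduct.lift_π]
    rw [biproduct.ι_π_ne _ (by simp), zero_comp, comp_zero]
  refine ⟨⟨biprod.desc (r.i ≫ biproduct.desc fun i => biproduct.ι f (Sum.inl i))
      (s.i ≫ biproduct.desc fun i => biproduct.ι f (Sum.inr i)),
    biprod.lift ((biproduct.lift fun i => biproduct.π f (Sum.inl i)) ≫ r.r)
      ((biproduct.lift fun i => biproduct.π f (Sum.inr i)) ≫ s.r), ?_⟩⟩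
  ext <;> simp [reassoc_of% h₁, reassoc_of% h₂, reassoc_of% h₃, reassoc_of% h₄]

theorem addClosure_biprod {P : ObjectProperty C} {X Y : C} (hX : addClosure P X)
    (hY : addClosure P Y) : addClosure P (X ⊞ Y) := by
  obtain ⟨k, f, hf, ⟨r⟩⟩ := hX
  obtain ⟨l, g, hg, ⟨s⟩⟩ := hY
  obtain ⟨t⟩ := exists_retract_biproduct_sum (Sum.elim f g) r s
  exact addClosure_of_finite (Sum.elim f g) (by rintro (i | i) <;> simp [hf, hg]) t

/-- A property stable under zero objects, binary biproducts and retracts that holds for the objects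
of `P` holds on `add P`. -/
theorem addClosure_le {P Q : ObjectProperty C} (hzero : ∀ X, IsZero X → Q X)
    (hbiprod : ∀ X Y, Q X → Q Y → Q (X ⊞ Y)) (hretract : ∀ X Y, Retract X Y → Q Y → Q X)
    (h : ∀ X, P X → Q X) {X : C} (hX : addClosure P X) : Q X := by
  obtain ⟨k, f, hf, ⟨r⟩⟩ := hX
  refine hretract _ _ r ?_
  clear r
  induction k with
  | zero => exact hzero _ ((IsZero.iff_id_eq_zero _).2 (by ext i; exact i.elim0))
  | succ k ih =>
    refine hretract _ (f 0 ⊞ ⨁ fun i : Fin k => f i.succ) ?_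
      (hbiprod _ _ (h _ (hf 0)) (ih _ fun i => hf _))
    refine ⟨biprod.lift (biproduct.π f 0) (biproduct.lift fun i => biproduct.π f i.succ),
      biprod.desc (biproduct.ι f 0) (biproduct.desc fun i => biproduct.ι f i.succ), ?_⟩
    rw [biprod.lift_desc, biproduct.lift_desc, ← biproduct.total, Fin.sum_univ_succ]

theorem addClosure_mono {P Q : ObjectProperty C} (h : ∀ X, P X → addClosure Q X) {X : C}
    (hX : addClosure P X) : addClosure Q X :=
  addClosure_le (fun _ => addClosure_zero) (fun _ _ => addClosure_biprod)
    (fun _ _ => addClosure_retract) h hX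

theorem addClosure_map (F : C ⥤ D) [F.Additive] {P : ObjectProperty C} {Q : ObjectProperty D}
    (h : ∀ X, P X → addClosure Q (F.obj X)) {X : C} (hX : addClosure P X) :
    addClosure Q (F.obj X) :=
  have := preservesBinaryBiproducts_of_preservesBiproducts F
  addClosure_le (Q := fun X => addClosure Q (F.obj X)) (fun _ hX => addClosure_zero (F.map_isZero hX))
    (fun _ _ hX hY => addClosure_iso (F.mapBiprod _ _) (addClosure_biprod hX hY))
    (fun _ _ r hY => addClosure_retract (r.map F) hY) h hX

theorem projective_of_addClosure {P : ObjectProperty C} (h : ∀ X, P X → Projective X) {X : C}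
    (hX : addClosure P X) : Projective X :=
  addClosure_le (Q := fun X => Projective X) (fun _ h => (Projective.of_iso h.isoZero.symm inferInstance))
    (fun _ _ _ _ => inferInstance) (fun _ _ r _ => r.projective) h hX

end AddClosure

/-! ### Calculus of short exact sequences in an abelian category. -/

section ShortExactSeq

universe v v' u'

attribute [local instance] Abelian.hasFiniteBiproducts

variable {C : Type u} [Category.{v} C] [Abelian C] {D : Type u'} [Category.{v'} D] [Abelian D]

/-- There is a short exact sequence `0 ⟶ X ⟶ Y ⟶ Z ⟶ 0`. -/
def ShortExactSeq (X Y Z : C) : Prop :=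
  ∃ (i : X ⟶ Y) (p : Y ⟶ Z) (w : i ≫ p = 0), (ShortComplex.mk i p w).ShortExact

/-- Since `i` is mono, lifts are automatically unique, so their mere existence makes `i` a kernel of
`p`. -/
theorem shortExact_of_lift {X Y Z : C} (i : X ⟶ Y) (p : Y ⟶ Z) (w : i ≫ p = 0) [Mono i] [Epi p]
    (h : ∀ {W : C} (g : W ⟶ Y), g ≫ p = 0 → ∃ l : W ⟶ X, l ≫ i = g) :
    (ShortComplex.mk i p w).ShortExact where
  exact := ShortComplex.exact_of_f_is_kernel _
    (KernelFork.IsLimit.ofι' _ _ fun g hg => ⟨(h g hg).choose, (h g hg).choose_spec⟩)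

theorem shortExact_of_desc {X Y Z : C} (i : X ⟶ Y) (p : Y ⟶ Z) (w : i ≫ p = 0) [Mono i] [Epi p]
    (h : ∀ {W : C} (g : Y ⟶ W), i ≫ g = 0 → ∃ l : Z ⟶ W, p ≫ l = g) :
    (ShortComplex.mk i p w).ShortExact where
  exact := ShortComplex.exact_of_g_is_cokernel _
    (CokernelCofork.IsColimit.ofπ' _ _ fun g hg => ⟨(h g hg).choose, (h g hg).choose_spec⟩)

theorem exists_lift_of_shortExact {S : ShortComplex C} (hS : S.ShortExact) {W : C} (g : W ⟶ S.X₂)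
    (hg : g ≫ S.g = 0) : ∃ l : W ⟶ S.X₁, l ≫ S.f = g :=
  ⟨_, KernelFork.IsLimit.lift' hS.fIsKernel g hg |>.2⟩

theorem exists_desc_of_shortExact {S : ShortComplex C} (hS : S.ShortExact) {W : C} (g : S.X₂ ⟶ W)
    (hg : S.f ≫ g = 0) : ∃ l : S.X₃ ⟶ W, S.g ≫ l = g :=
  ⟨_, CokernelCofork.IsColimit.desc' hS.gIsCokernel g hg |>.2⟩

theorem shortExactSeq_kernel {Y Z : C} (p : Y ⟶ Z) [Epi p] : ShortExactSeq (kernel p) Y Z :=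
  ⟨kernel.ι p, p, kernel.condition p,
    shortExact_of_lift _ _ _ fun g hg => ⟨kernel.lift p g hg, by simp⟩⟩

namespace ShortExactSeq

theorem of_iso {X Y Z X' Y' Z' : C} (h : ShortExactSeq X Y Z) (e₁ : X ≅ X') (e₂ : Y ≅ Y')
    (e₃ : Z ≅ Z') : ShortExactSeq X' Y' Z' := by
  obtain ⟨i, p, w, h⟩ := h
  refine ⟨e₁.inv ≫ i ≫ e₂.hom, e₂.inv ≫ p ≫ e₃.hom, by simp [reassoc_of% w], ?_⟩
  exact ShortComplex.shortExact_of_iso (ShortComplex.isoMk e₁ e₂ e₃ (by simp) (by simp)) h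

theorem map {X Y Z : C} (h : ShortExactSeq X Y Z) (F : C ⥤ D) [F.Additive]
    [PreservesFiniteLimits F] [PreservesFiniteColimits F] :
    ShortExactSeq (F.obj X) (F.obj Y) (F.obj Z) := by
  obtain ⟨i, p, w, h⟩ := h
  exact ⟨F.map i, F.map p, by rw [← F.map_comp, w, F.map_zero], h.map_of_exact F⟩

theorem of_isZero_left {X Y Z : C} (hX : IsZero X) (e : Y ≅ Z) : ShortExactSeq X Y Z := by
  have : Mono (0 : X ⟶ Y) := ⟨fun _ _ _ => hX.eq_of_tgt _ _⟩
  exact ⟨0, e.hom, zero_comp, shortExact_of_lift _ _ _ fun g hg =>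
    ⟨0, by rw [← cancel_mono e.hom, hg]; simp⟩⟩

theorem of_isZero_right {X Y Z : C} (hZ : IsZero Z) (e : X ≅ Y) : ShortExactSeq X Y Z := by
  have : Epi (0 : Y ⟶ Z) := ⟨fun _ _ _ => hZ.eq_of_src _ _⟩
  exact ⟨e.hom, 0, comp_zero, shortExact_of_lift _ _ _ fun g hg => ⟨g ≫ e.inv, by simp⟩⟩

theorem iso_of_isZero_left {X Y Z : C} (h : ShortExactSeq X Y Z) (hX : IsZero X) :
    Nonempty (Y ≅ Z) := by
  obtain ⟨i, p, w, h⟩ := h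
  have := h.epi_g
  have : Mono p := (ShortComplex.exact_iff_mono _ (hX.eq_of_src _ _)).1 h.exact
  have := isIso_of_mono_of_epi p
  exact ⟨asIso p⟩

theorem iso_of_isZero_right {X Y Z : C} (h : ShortExactSeq X Y Z) (hZ : IsZero Z) :
    Nonempty (X ≅ Y) := by
  obtain ⟨i, p, w, h⟩ := h
  have := h.mono_f
  have : Epi i := (ShortComplex.exact_iff_epi _ (hZ.eq_of_tgt _ _)).1 h.exact
  have := isIso_of_mono_of_epi i
  exact ⟨asIso i⟩

theorem biprod {X Y Z X' Y' Z' : C} (h : ShortExactSeq X Y Z) (h' : ShortExactSeq X' Y' Z') :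
    ShortExactSeq (X ⊞ X') (Y ⊞ Y') (Z ⊞ Z') := by
  obtain ⟨i, p, w, h⟩ := h
  obtain ⟨i', p', w', h'⟩ := h'
  have := h.mono_f; have := h.epi_g; have := h'.mono_f; have := h'.epi_g
  dsimp at *
  refine ⟨biprod.map i i', biprod.map p p', by ext <;> simp [w, w'], shortExact_of_lift _ _ _ ?_⟩
  intro W g hg
  obtain ⟨l, hl⟩ := exists_lift_of_shortExact h (g ≫ biprod.fst) (by
    simpa using congr($hg ≫ biprod.fst))
  obtain ⟨l', hl'⟩ := exists_lift_of_shortExact h' (g ≫ biprod.snd) (by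
    simpa using congr($hg ≫ biprod.snd))
  dsimp at *
  exact ⟨biprod.lift l l', by ext <;> simp [hl, hl']⟩

/-- The kernel of a composition of two epimorphisms is an extension of their kernels. -/
theorem kernel_comp {K A B L E : C} (h : ShortExactSeq K A B) (h' : ShortExactSeq L B E) :
    ∃ X, ShortExactSeq X A E ∧ ShortExactSeq K X L := by
  obtain ⟨i, p, w, h⟩ := h
  obtain ⟨j, q, w', h'⟩ := h'
  have := h.mono_f; have := h.epi_g; have := h'.mono_f; have := h'.epi_g
  dsimp at *
  -- The kernel of `p ≫ q` is the preimage under `p` of the subobject `L` of `B`.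
  refine ⟨pullback p j, ⟨pullback.fst p j, p ≫ q, by rw [pullback.condition_assoc, w', comp_zero],
    shortExact_of_lift _ _ _ ?_⟩, ⟨pullback.lift i 0 (by simp [w]), pullback.snd p j, pullback.lift_snd _ _ _,
    ?_⟩⟩
  · intro W g hg
    obtain ⟨l, hl⟩ := exists_lift_of_shortExact h' (g ≫ p) (by simpa using hg)
    exact ⟨pullback.lift g l hl.symm, pullback.lift_fst _ _ _⟩
  · have : Mono (pullback.lift (f := p) (g := j) i 0 (by simp [w])) := by
      have : Mono (pullback.lift (f := p) (g := j) i 0 (by simp [w]) ≫ pullback.fst p j) := by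
        simpa [pullback.lift_fst]
      exact mono_of_mono _ (pullback.fst p j)
    refine shortExact_of_lift _ _ _ ?_
    intro W g hg
    obtain ⟨l, hl⟩ := exists_lift_of_shortExact h (g ≫ pullback.fst p j) (by
      rw [Category.assoc, pullback.condition, reassoc_of% hg, zero_comp])
    dsimp at hl
    exact ⟨l, by ext <;> simp [pullback.lift_fst, pullback.lift_snd, hl, hg]⟩

/-- The cokernel of a composition of two monomorphisms is an extension of their cokernels. -/
theorem cokernel_comp {X E Q A Y : C} (h : ShortExactSeq X E Q) (h' : ShortExactSeq E A Y) :
    ∃ W, ShortExactSeq X A W ∧ ShortExactSeq Q W Y := by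
  obtain ⟨i, p, w, h⟩ := h
  obtain ⟨j, q, w', h'⟩ := h'
  have := h.mono_f; have := h.epi_g; have := h'.mono_f; have := h'.epi_g
  dsimp at *
  -- Dually to `kernel_comp`, the cokernel of `i ≫ j` is the pushout of `A` along the quotient `E ⟶
  -- Q`.
  refine ⟨pushout j p, ⟨i ≫ j, pushout.inl j p, by simp [pushout.condition, reassoc_of% w],
    shortExact_of_desc _ _ _ ?_⟩, ⟨pushout.inr j p, pushout.desc q 0 (by simp [w']), pushout.inr_desc _ _ _,
    ?_⟩⟩
  · intro W g hg
    obtain ⟨l, hl⟩ := exists_desc_of_shortExact h (j ≫ g) (by simpa using hg)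
    exact ⟨pushout.desc g l hl.symm, pushout.inl_desc _ _ _⟩
  · have : Epi (pushout.desc (f := j) (g := p) q 0 (by simp [w'])) := by
      have : Epi (pushout.inl j p ≫ pushout.desc (f := j) (g := p) q 0 (by simp [w'])) := by
        simpa [pushout.inl_desc]
      exact epi_of_epi (pushout.inl j p) _
    refine shortExact_of_desc _ _ _ ?_
    intro W g hg
    obtain ⟨l, hl⟩ := exists_desc_of_shortExact h' (pushout.inl j p ≫ g) (by
      simp [pushout.condition_assoc, hg])
    dsimp at hl
    exact ⟨l, by ext <;> simp [pushout.inl_desc_assoc, pushout.inr_desc_assoc, hl, hg]⟩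

/-- An extension of `Y` by a retract of `E` is a retract of an extension of `Y` by `E`. -/
theorem exists_retract_left {X A Y E : C} (h : ShortExactSeq X A Y) (r : Retract X E) :
    ∃ A', ShortExactSeq E A' Y ∧ Nonempty (Retract A A') := by
  obtain ⟨i, p, w, h⟩ := h
  have := h.mono_f; have := h.epi_g
  dsimp at *
  -- Push the extension out along `r.i`. The maps `𝟙 A` and `r.r ≫ i` agree on `X` and so define the
  -- retraction onto `A`.
  refine ⟨pushout i r.i, ⟨pushout.inr i r.i, pushout.desc p 0 (by simp [w]), pushout.inr_desc _ _ _, ?_⟩,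
    ⟨pushout.inl i r.i, pushout.desc (𝟙 A) (r.r ≫ i) (by simp), pushout.inl_desc _ _ _⟩⟩
  have : Epi (pushout.desc (f := i) (g := r.i) p 0 (by simp [w])) := by
    have : Epi (pushout.inl i r.i ≫ pushout.desc (f := i) (g := r.i) p 0 (by simp [w])) := by
      simpa [pushout.inl_desc]
    exact epi_of_epi (pushout.inl i r.i) _
  refine shortExact_of_desc _ _ _ ?_
  intro W g hg
  obtain ⟨l, hl⟩ := exists_desc_of_shortExact h (pushout.inl i r.i ≫ g) (by
    simp [pushout.condition_assoc, hg])
  dsimp at hl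
  exact ⟨l, by ext <;> simp [pushout.inl_desc_assoc, pushout.inr_desc_assoc, hl, hg]⟩

/-- If `0 ⟶ X ⟶ Y ⟶ Z ⟶ 0` and `0 ⟶ Z' ⟶ Q ⟶ Z ⟶ 0` are exact with `Q` projective, there is
an exact sequence `0 ⟶ Z' ⟶ X ⊞ Q ⟶ Y ⟶ 0`. -/
theorem rotate {X Y Z Z' Q : C} [Projective Q] (h : ShortExactSeq X Y Z)
    (h' : ShortExactSeq Z' Q Z) : ShortExactSeq Z' (X ⊞ Q) Y := by
  obtain ⟨i, p, w, h⟩ := h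
  obtain ⟨j, q, w', h'⟩ := h'
  have := h.mono_f; have := h.epi_g; have := h'.mono_f; have := h'.epi_g
  dsimp at *
  -- The fibre product of `Y` and `Q` over `Z` is an extension of `Q` by `X`. The lift `s` splits it
  -- as `X ⊞ Q`, and `l` measures `s` on `Z'`.
  let s : Q ⟶ Y := Projective.factorThru q p
  have hs : s ≫ p = q := Projective.factorThru_comp q p
  obtain ⟨l, hl⟩ := exists_lift_of_shortExact h (j ≫ s) (by simp [hs, w'])
  dsimp at hl
  have : Mono (biprod.lift (-l) j) := by
    have : Mono (biprod.lift (-l) j ≫ biprod.snd) := by simpa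
    exact mono_of_mono _ biprod.snd
  have : Epi (biprod.desc i s) := by
    refine Preadditive.epi_of_cancel_zero _ fun {W} g hg => ?_
    have h₁ : i ≫ g = 0 := by simpa using congr(biprod.inl ≫ $hg)
    have h₂ : s ≫ g = 0 := by simpa using congr(biprod.inr ≫ $hg)
    obtain ⟨k, hk⟩ := exists_desc_of_shortExact h g h₁
    dsimp at hk
    have : q ≫ k = 0 := by rw [← hs, Category.assoc, hk, h₂]
    rw [← hk, (cancel_epi q).1 (this.trans comp_zero.symm), comp_zero]
  refine ⟨biprod.lift (-l) j, biprod.desc i s, by simp [hl], shortExact_of_lift _ _ _ ?_⟩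
  intro W g hg
  have hg' : (g ≫ biprod.fst) ≫ i + (g ≫ biprod.snd) ≫ s = 0 := by
    rw [← hg, biprod.desc_eq]; simp
  obtain ⟨c, hc⟩ := exists_lift_of_shortExact h' (g ≫ biprod.snd) (by
    have := congr($hg' ≫ p)
    simpa [w, hs] using this)
  dsimp at hc
  refine ⟨c, ?_⟩
  ext
  · rw [← cancel_mono i]
    simp only [Category.assoc, biprod.lift_fst, Preadditive.neg_comp, Preadditive.comp_neg]
    rw [hl, reassoc_of% hc, eq_comm, eq_neg_iff_add_eq_zero]
    simpa using hg'
  · simpa using hc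

/-- A kernel of an epimorphism from a projective onto a retract of `B` is, up to a projective
summand, a retract of the kernel of any epimorphism from a projective onto `B`. -/
theorem retract_syzygy {A A' P B B' Q : C} [Projective P] [Projective Q]
    (h : ShortExactSeq A' P A) (h' : ShortExactSeq B' Q B) (r : Retract A B) :
    Nonempty (Retract A' (B' ⊞ P)) := by
  obtain ⟨i, p, w, h⟩ := h
  obtain ⟨j, q, w', h'⟩ := h'
  have := h.mono_f; have := h.epi_g; have := h'.mono_f; have := h'.epi_g
  dsimp at *
  -- As in Schanuel's lemma, `s` and `t` lift the two maps of the retract. The error `𝟙 P - s ≫ t`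
  -- vanishes in `A`, so it factors as `c ≫ i`, and `a ≫ b + i ≫ c` is the identity of `A'`.
  let s : P ⟶ Q := Projective.factorThru (p ≫ r.i) q
  have hs : s ≫ q = p ≫ r.i := Projective.factorThru_comp _ _
  let t : Q ⟶ P := Projective.factorThru (q ≫ r.r) p
  have ht : t ≫ p = q ≫ r.r := Projective.factorThru_comp _ _
  obtain ⟨a, ha⟩ := exists_lift_of_shortExact h' (i ≫ s) (by simp [hs, reassoc_of% w])
  obtain ⟨b, hb⟩ := exists_lift_of_shortExact h (j ≫ t) (by simp [ht, reassoc_of% w'])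
  obtain ⟨c, hc⟩ := exists_lift_of_shortExact h (𝟙 P - s ≫ t) (by
    simp [Preadditive.sub_comp, ht, reassoc_of% hs])
  dsimp at *
  refine ⟨⟨biprod.lift a i, biprod.desc b c, ?_⟩⟩
  rw [← cancel_mono i]
  simp [biprod.lift_desc, Preadditive.add_comp, hb, hc, reassoc_of% ha, Preadditive.comp_sub]

end ShortExactSeq

end ShortExactSeq

/-! ### Comparing infima with values in `ℕ∞`. -/

section ENatInfimum

theorem iInf_natCast_le_of_imp {P Q : ℕ → Prop} (h : ∀ m, Q m → P m) :
    (⨅ (m : ℕ) (_ : P m), (m : ℕ∞)) ≤ ⨅ (m : ℕ) (_ : Q m), (m : ℕ∞) :=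
  le_iInf₂ fun m hm => iInf₂_le m (h m hm)

/-- If some `m` satisfies `Q`, the infimum is attained at the least one. Otherwise the right side is
`⊤`, which uses `n ≠ 0`. -/
theorem iInf_natCast_le_mul {P Q : ℕ → Prop} {n : ℕ} (hn : 1 ≤ n)
    (h : ∀ m, Q m → P (n * (m + 1) - 1)) :
    (⨅ (m : ℕ) (_ : P m), (m : ℕ∞)) ≤ n * ((⨅ (m : ℕ) (_ : Q m), (m : ℕ∞)) + 1) - 1 := by
  classical
  by_cases hQ : ∃ m, Q m
  · have hmin : (⨅ (m : ℕ) (_ : Q m), (m : ℕ∞)) = (Nat.find hQ : ℕ) :=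
      le_antisymm (iInf₂_le _ (Nat.find_spec hQ))
        (le_iInf₂ fun m hm => by exact_mod_cast Nat.find_min' hQ hm)
    rw [hmin]
    refine (iInf₂_le _ (h _ (Nat.find_spec hQ))).trans ?_
    norm_cast
  · have htop : (⨅ (m : ℕ) (_ : Q m), (m : ℕ∞)) = ⊤ := by
      simp only [iInf_eq_top]
      exact fun m hm => (hQ ⟨m, hm⟩).elim
    have hn' : (n : ℕ∞) ≠ 0 := by exact_mod_cast Nat.one_le_iff_ne_zero.1 hn
    rw [htop, top_add, ENat.mul_top hn']
    exact le_top

end ENatInfimum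

/-! ### Extension powers and the extension dimension. -/

section ExtensionDimension

universe v v' u'

attribute [local instance] Abelian.hasFiniteBiproducts

variable {C : Type u} [Category.{v} C] [Abelian C] {D : Type u'} [Category.{v'} D] [Abelian D]

theorem extensionPower_succ_succ {P : ObjectProperty C} (n : ℕ) :
    extensionPower P (n + 2) = extensionProduct (addClosure P) (extensionPower P (n + 1)) := by
  rw [extensionPower]

theorem extensionPower_retract {P : ObjectProperty C} :
    ∀ (n : ℕ) {X Y : C} (_ : Retract X Y), extensionPower P n Y → extensionPower P n X
  | 0, _, _, r, h => (IsZero.iff_id_eq_zero _).2 (by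
      rw [← r.retract, IsZero.eq_of_tgt h r.i 0, zero_comp])
  | 1, _, _, r, h => addClosure_retract r h
  | n + 2, _, _, r, h => by
    rw [extensionPower_succ_succ] at h ⊢
    exact addClosure_retract r h

theorem extensionPower_iso {P : ObjectProperty C} (n : ℕ) {X Y : C} (e : X ≅ Y)
    (h : extensionPower P n Y) : extensionPower P n X :=
  extensionPower_retract n (Retract.ofIso e) h

theorem extensionPower_zero {P : ObjectProperty C} :
    ∀ (n : ℕ) {X : C}, IsZero X → extensionPower P n X
  | 0, _, h => h
  | 1, _, h => addClosure_zero h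
  | n + 2, _, h => by
    rw [extensionPower_succ_succ]
    exact addClosure_zero h

theorem extensionPower_biprod {P : ObjectProperty C} :
    ∀ (n : ℕ) {X Y : C}, extensionPower P n X → extensionPower P n Y →
      extensionPower P n (X ⊞ Y)
  | 0, _, _, hX, hY => (biprod_isZero_iff _ _).2 ⟨hX, hY⟩
  | 1, _, _, hX, hY => addClosure_biprod hX hY
  | n + 2, _, _, hX, hY => by
    rw [extensionPower_succ_succ] at hX hY ⊢
    exact addClosure_biprod hX hY

theorem extensionPower_succ_of_shortExactSeq {P : ObjectProperty C} :
    ∀ (n : ℕ) {X A Y : C}, ShortExactSeq X A Y → addClosure P X → extensionPower P n Y →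
      extensionPower P (n + 1) A
  | 0, _, _, _, h, hX, hY => by
      obtain ⟨e⟩ := h.iso_of_isZero_right hY
      exact addClosure_iso e.symm hX
  | n + 1, X, _, Y, ⟨i, p, w, h⟩, hX, hY => by
    rw [extensionPower_succ_succ]
    exact addClosure_of ⟨X, Y, i, p, w, hX, hY, h⟩

/-- Finite sums of extensions are extensions of the sums, so the only closure left in `add` is that
under retracts. The case `n = 0` is the extension with zero quotient, which makes later inductions
uniform. -/
theorem exists_retract_of_extensionPower {P : ObjectProperty C} (n : ℕ) {A : C}
    (hA : extensionPower P (n + 1) A) :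
    ∃ X E Y : C, Nonempty (Retract A E) ∧ ShortExactSeq X E Y ∧ addClosure P X ∧
      extensionPower P n Y := by
  cases n with
  | zero => exact ⟨A, A, 0, ⟨Retract.refl A⟩, .of_isZero_right (isZero_zero C) (Iso.refl A), hA,
      isZero_zero C⟩
  | succ n =>
    rw [extensionPower_succ_succ] at hA
    refine addClosure_le (Q := fun A => ∃ X E Y : C, Nonempty (Retract A E) ∧
      ShortExactSeq X E Y ∧ addClosure P X ∧ extensionPower P (n + 1) Y) ?_ ?_ ?_ ?_ hA
    · intro X hX
      exact ⟨X, X, X, ⟨Retract.refl X⟩, .of_isZero_left hX (Iso.refl X), addClosure_zero hX,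
        extensionPower_zero _ hX⟩
    · rintro A B ⟨X, E, Y, ⟨r⟩, h, hX, hY⟩ ⟨X', E', Y', ⟨r'⟩, h', hX', hY'⟩
      exact ⟨X ⊞ X', E ⊞ E', Y ⊞ Y', ⟨⟨biprod.map r.i r'.i, biprod.map r.r r'.r, by
        ext <;> simp⟩⟩, h.biprod h', addClosure_biprod hX hX', extensionPower_biprod _ hY hY'⟩
    · rintro A B r ⟨X, E, Y, ⟨s⟩, h⟩
      exact ⟨X, E, Y, ⟨r.trans s⟩, h⟩
    · rintro A ⟨X, Y, i, p, w, hX, hY, h⟩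
      exact ⟨X, A, Y, ⟨Retract.refl A⟩, ⟨i, p, w, h⟩, hX, hY⟩

/-- Extensions are associative: peel the first factor `X'` off `X`; the quotient by `X'` is then an
extension of `Y` by `X''`. Peeling works only for an object `E` of which `X` is a retract, so `A` is
first enlarged to `A'`. -/
theorem extensionPower_add {P : ObjectProperty C} (a b : ℕ) {X A Y : C}
    (h : ShortExactSeq X A Y) (hX : extensionPower P a X) (hY : extensionPower P b Y) :
    extensionPower P (a + b) A := by
  induction a generalizing X A Y with
  | zero =>
    obtain ⟨e⟩ := h.iso_of_isZero_left hX
    rw [zero_add]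
    exact extensionPower_iso b e hY
  | succ a ih =>
    obtain ⟨X', E, X'', ⟨r⟩, hE, hX', hX''⟩ := exists_retract_of_extensionPower a hX
    obtain ⟨A', hA', ⟨s⟩⟩ := h.exists_retract_left r
    obtain ⟨W, h₁, h₂⟩ := hE.cokernel_comp hA'
    rw [show a + 1 + b = a + b + 1 by ring]
    exact extensionPower_retract _ s
      (extensionPower_succ_of_shortExactSeq _ h₁ hX' (ih h₂ hX'' hY))

theorem extensionPower_map (F : C ⥤ D) [F.Additive] [PreservesFiniteLimits F]
    [PreservesFiniteColimits F] {P : ObjectProperty C} {Q : ObjectProperty D}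
    (h : ∀ X, P X → addClosure Q (F.obj X)) (n : ℕ) {X : C} (hX : extensionPower P n X) :
    extensionPower Q n (F.obj X) := by
  induction n generalizing X with
  | zero => exact F.map_isZero hX
  | succ n ih =>
    obtain ⟨X', E, X'', ⟨r⟩, hE, hX', hX''⟩ := exists_retract_of_extensionPower n hX
    exact extensionPower_retract _ (r.map F) (extensionPower_succ_of_shortExactSeq _ (hE.map F)
      (addClosure_map F h hX') (ih hX''))

/-- An exact essentially surjective functor does not increase the extension dimension. -/
theorem extensionDimension_le_of_essSurj (F : C ⥤ D) [F.Additive] [PreservesFiniteLimits F]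
    [PreservesFiniteColimits F] [F.EssSurj] : extensionDimension D ≤ extensionDimension C := by
  refine iInf_natCast_le_of_imp ?_
  rintro m ⟨T, hT⟩
  refine ⟨F.obj T, fun A => extensionPower_iso _ (F.objObjPreimageIso A).symm
    (extensionPower_map F ?_ _ (hT (F.objPreimage A)))⟩
  rintro _ rfl
  exact addClosure_of rfl

end ExtensionDimension

/-! ### Filtrations by iterated kernels of a natural transformation. -/

section NilpotentLength

universe w₁ w₂ w₃ w₄

theorem shortExactSeq_kernel_app {C : Type w₁} [Category.{w₂} C] [Abelian C] {D : Type w₃}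
    [Category.{w₄} D] {L : C ⥤ D} {Z : D ⥤ C} (η : 𝟭 C ⟶ L ⋙ Z) (X : C) [Epi (η.app X)] :
    ShortExactSeq (kernel (η.app X)) X (Z.obj (L.obj X)) :=
  shortExactSeq_kernel (η.app X)

universe v v' u'

variable {A : Type u} [Category.{v} A] [Abelian A] {B : Type u'} [Category.{v'} B] [Abelian B]

/-- Given a natural transformation `η : 𝟭 B ⟶ L ⋙ Z`, this says that taking `k` times the kernel
of `η` turns the object into a zero object. -/
def HasNilpotentLength {L : B ⥤ A} {Z : A ⥤ B} (η : 𝟭 B ⟶ L ⋙ Z) : ℕ → B → Prop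
  | 0, X => IsZero X
  | k + 1, X => HasNilpotentLength η k (kernel (η.app X))

variable {L : B ⥤ A} {Z : A ⥤ B} (η : 𝟭 B ⟶ L ⋙ Z) [∀ X, Epi (η.app X)]

/-- Each layer `Z (L X)` costs `m` steps and the kernel has one layer fewer, so `k` layers cost `k *
m`. -/
theorem extensionPower_of_hasNilpotentLength [Z.Additive] [PreservesFiniteLimits Z]
    [PreservesFiniteColimits Z] {T : A} {m : ℕ}
    (hT : ∀ X, extensionPower (fun X => X = T) m X) (k : ℕ) {X : B}
    (hX : HasNilpotentLength η k X) : extensionPower (fun X => X = Z.obj T) (k * m) X := by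
  induction k generalizing X with
  | zero =>
    rw [zero_mul]
    exact hX
  | succ k ih =>
    rw [add_mul, one_mul]
    refine extensionPower_add _ _ (shortExactSeq_kernel_app η X) (ih hX)
      (extensionPower_map Z ?_ _ (hT _))
    rintro _ rfl
    exact addClosure_of rfl

theorem extensionDimension_le_mul [Z.Additive] [PreservesFiniteLimits Z]
    [PreservesFiniteColimits Z] {n : ℕ} (hn : 1 ≤ n) (hnil : ∀ X, HasNilpotentLength η n X) :
    extensionDimension B ≤ n * (extensionDimension A + 1) - 1 := by
  refine iInf_natCast_le_mul hn ?_
  rintro m ⟨T, hT⟩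
  refine ⟨Z.obj T, fun X => ?_⟩
  -- A value `m` of the dimension means `m + 1` steps. The `n` layers take `n * (m + 1)` steps,
  -- which is positive, so the truncated subtraction loses nothing.
  rw [Nat.sub_add_cancel (Nat.mul_pos hn m.succ_pos)]
  exact extensionPower_of_hasNilpotentLength η hT n (hnil X)

end NilpotentLength

/-! ### Syzygies, `add`-resolutions and the Igusa-Todorov distance. -/

section IgusaTodorov

universe v v' u'

attribute [local instance] Abelian.hasFiniteBiproducts

variable {C : Type u} [Category.{v} C] [Abelian C] {D : Type u'} [Category.{v'} D] [Abelian D]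

theorem addClosure_eq_biprod_left {U V X : C} (h : addClosure (fun X => X = U) X) :
    addClosure (fun X => X = (U ⊞ V)) X :=
  addClosure_mono (by
    rintro _ rfl
    exact addClosure_retract ⟨biprod.inl, biprod.fst, by simp⟩ (addClosure_of rfl)) h

theorem addClosure_eq_biprod_right {U V X : C} (h : addClosure (fun X => X = V) X) :
    addClosure (fun X => X = (U ⊞ V)) X :=
  addClosure_mono (by
    rintro _ rfl
    exact addClosure_retract ⟨biprod.inr, biprod.snd, by simp⟩ (addClosure_of rfl)) h

theorem hasAddResolution_succ_iff {U : C} {m : ℕ} {A : C} :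
    HasAddResolution U (m + 1) A ↔ ∃ K U₀ : C, addClosure (fun X => X = U) U₀ ∧
      ShortExactSeq K U₀ A ∧ HasAddResolution U m K :=
  ⟨fun ⟨K, U₀, i, p, w, h₁, h₂, h₃⟩ => ⟨K, U₀, h₁, ⟨i, p, w, h₂⟩, h₃⟩,
    fun ⟨K, U₀, h₁, ⟨i, p, w, h₂⟩, h₃⟩ => ⟨K, U₀, i, p, w, h₁, h₂, h₃⟩⟩

theorem isSyzygy_succ_iff {n : ℕ} {A K : C} :
    IsSyzygy (n + 1) A K ↔ ∃ L P : C, IsSyzygy n A L ∧ Projective P ∧ ShortExactSeq K P L :=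
  ⟨fun ⟨L, P, i, p, w, h₁, h₂, h₃⟩ => ⟨L, P, h₁, h₂, ⟨i, p, w, h₃⟩⟩,
    fun ⟨L, P, h₁, h₂, ⟨i, p, w, h₃⟩⟩ => ⟨L, P, i, p, w, h₁, h₂, h₃⟩⟩

theorem hasAddResolution_map (F : C ⥤ D) [F.Additive] [PreservesFiniteLimits F]
    [PreservesFiniteColimits F] {U : C} {V : D} (h : addClosure (fun X => X = V) (F.obj U))
    (m : ℕ) {A : C} (hA : HasAddResolution U m A) : HasAddResolution V m (F.obj A) := by
  induction m generalizing A with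
  | zero => exact addClosure_map F (by rintro _ rfl; exact h) hA
  | succ m ih =>
    obtain ⟨K, U₀, h₁, h₂, h₃⟩ := hasAddResolution_succ_iff.1 hA
    exact hasAddResolution_succ_iff.2 ⟨_, _, addClosure_map F (by rintro _ rfl; exact h) h₁,
      h₂.map F, ih h₃⟩

theorem hasAddResolution_mono {U V : C} (h : addClosure (fun X => X = V) U) (m : ℕ) {A : C}
    (hA : HasAddResolution U m A) : HasAddResolution V m A :=
  hasAddResolution_map (𝟭 C) h m hA

theorem isSyzygy_map (F : C ⥤ D) [F.Additive] [PreservesFiniteLimits F]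
    [PreservesFiniteColimits F] [F.PreservesProjectiveObjects] (n : ℕ) {A K : C}
    (h : IsSyzygy n A K) : IsSyzygy n (F.obj A) (F.obj K) := by
  induction n generalizing K with
  | zero => obtain ⟨e⟩ := h; exact ⟨F.mapIso e⟩
  | succ n ih =>
    obtain ⟨L, P, h₁, h₂, h₃⟩ := isSyzygy_succ_iff.1 h
    exact isSyzygy_succ_iff.2 ⟨_, _, ih h₁, F.projective_obj P, h₃.map F⟩

theorem isSyzygy_iso (n : ℕ) {A B K : C} (e : A ≅ B) (h : IsSyzygy n A K) : IsSyzygy n B K := by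
  induction n generalizing K with
  | zero => obtain ⟨e'⟩ := h; exact ⟨e' ≪≫ e⟩
  | succ n ih =>
    obtain ⟨L, P, h₁, h₂, h₃⟩ := isSyzygy_succ_iff.1 h
    exact isSyzygy_succ_iff.2 ⟨_, _, ih h₁, h₂, h₃⟩

/-- An exact essentially surjective functor which preserves projective objects does not increase
the Igusa-Todorov distance. -/
theorem igusaTodorovDistance_le_of_essSurj (F : C ⥤ D) [F.Additive] [PreservesFiniteLimits F]
    [PreservesFiniteColimits F] [F.PreservesProjectiveObjects] [F.EssSurj] :
    igusaTodorovDistance D ≤ igusaTodorovDistance C := by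
  refine iInf_natCast_le_of_imp ?_
  rintro m ⟨n, U, hU⟩
  refine ⟨n, F.obj U, fun A => ?_⟩
  obtain ⟨K, h₁, h₂⟩ := hU (F.objPreimage A)
  exact ⟨F.obj K, isSyzygy_iso n (F.objObjPreimageIso A) (isSyzygy_map F n h₁),
    hasAddResolution_map F (addClosure_of rfl) m h₂⟩

/-- The horseshoe lemma for syzygies. -/
theorem exists_isSyzygy_of_shortExactSeq (n : ℕ) {X Y Z K M : C} (h : ShortExactSeq X Y Z)
    (hX : IsSyzygy n X K) (hZ : IsSyzygy n Z M) :
    ∃ E, IsSyzygy n Y E ∧ ShortExactSeq K E M := by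
  induction n generalizing K M with
  | zero =>
    obtain ⟨e⟩ := hX
    obtain ⟨e'⟩ := hZ
    exact ⟨Y, ⟨Iso.refl Y⟩, h.of_iso e.symm (Iso.refl Y) e'.symm⟩
  | succ n ih =>
    obtain ⟨L, P, h₁, h₂, h₃⟩ := isSyzygy_succ_iff.1 hX
    obtain ⟨L', P', h₁', h₂', h₃'⟩ := isSyzygy_succ_iff.1 hZ
    obtain ⟨N, hN, hN'⟩ := ih h₁ h₁'
    -- Adding `P'` identically makes the cover of `L` composable with `0 ⟶ M ⟶ L ⊞ P' ⟶ N ⟶ 0`; the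
    -- new syzygy is the kernel of the composite `P ⊞ P' ⟶ N`.
    have h₄ : ShortExactSeq K (P ⊞ P') (L ⊞ P') :=
      (h₃.biprod (.of_isZero_left (isZero_zero C) (Iso.refl P'))).of_iso
        (isoBiprodZero (isZero_zero C)).symm (Iso.refl _) (Iso.refl _)
    obtain ⟨E, hE, hE'⟩ := h₄.kernel_comp (hN'.rotate h₃')
    exact ⟨E, isSyzygy_succ_iff.2 ⟨N, _, hN, inferInstance, hE⟩, hE'⟩

/-- There is a chain of `N` successive syzygies starting at the given object, all of which admit
an `add V`-resolution of length `m`, with projective covers in `add V`. -/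
def SyzygiesHaveAddResolution (V : C) (m : ℕ) : ℕ → C → Prop
  | 0, _ => True
  | N + 1, A => ∃ K P : C, addClosure (fun X => X = V) P ∧ Projective P ∧ ShortExactSeq K P A ∧
      HasAddResolution V m K ∧ SyzygiesHaveAddResolution V m N K

theorem syzygiesHaveAddResolution_mono {U V : C} (h : addClosure (fun X => X = V) U) (m : ℕ) :
    ∀ (N : ℕ) {A : C}, SyzygiesHaveAddResolution U m N A → SyzygiesHaveAddResolution V m N A
  | 0, _, _ => trivial
  | N + 1, _, ⟨K, P, h₁, h₂, h₃, h₄, h₅⟩ => ⟨K, P, addClosure_mono (by rintro _ rfl; exact h) h₁,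
      h₂, h₃, hasAddResolution_mono h m h₄, syzygiesHaveAddResolution_mono h m N h₅⟩

theorem SyzygiesHaveAddResolution.of_le {V : C} {m : ℕ} :
    ∀ {N N' : ℕ} (_ : N' ≤ N) {A : C}, SyzygiesHaveAddResolution V m N A →
      SyzygiesHaveAddResolution V m N' A
  | _, 0, _, _, _ => trivial
  | _ + 1, _ + 1, h, _, ⟨K, P, h₁, h₂, h₃, h₄, h₅⟩ =>
      ⟨K, P, h₁, h₂, h₃, h₄, h₅.of_le (Nat.le_of_succ_le_succ h)⟩

/-- `add V`-resolutions of the ends of a short exact sequence give one of the middle term. -/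
theorem hasAddResolution_of_shortExactSeq {V : C} (a b : ℕ) {X Y Z : C}
    (h : ShortExactSeq X Y Z) (hX : HasAddResolution V a X)
    (hZ : SyzygiesHaveAddResolution V b (a + 1) Z) : HasAddResolution V (a + b + 1) Y := by
  induction a generalizing X Y Z with
  | zero =>
    obtain ⟨K, P, hP, _, hK, hKres, -⟩ := hZ
    rw [zero_add]
    exact hasAddResolution_succ_iff.2 ⟨K, X ⊞ P, addClosure_biprod hX hP, h.rotate hK, hKres⟩
  | succ a ih =>
    obtain ⟨K, P, hP, _, hK, hKres, hK'⟩ := hZ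
    obtain ⟨X', U, hU, hX', hX'res⟩ := hasAddResolution_succ_iff.1 hX
    have h₁ : ShortExactSeq X' (U ⊞ P) (X ⊞ P) :=
      (hX'.biprod (.of_isZero_left (isZero_zero C) (Iso.refl P))).of_iso
        (isoBiprodZero (isZero_zero C)).symm (Iso.refl _) (Iso.refl _)
    -- The kernel `E` of `U ⊞ P ⟶ Y` is an extension of `K` by `X'`. Each resolution step of `X`
    -- thus consumes one syzygy of `Z`, which explains the `a + 1` syzygies required.
    obtain ⟨E, hE, hE'⟩ := h₁.kernel_comp (h.rotate hK)
    rw [show a + 1 + b + 1 = a + b + 1 + 1 by ring]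
    exact hasAddResolution_succ_iff.2 ⟨E, U ⊞ P, addClosure_biprod hU hP, hE, ih hE' hX'res hK'⟩

variable {G : C} [Projective G]

theorem projective_of_addClosure_eq {P : C} (h : addClosure (fun X => X = G) P) : Projective P :=
  projective_of_addClosure (by rintro _ rfl; infer_instance) h

/-- The syzygies of objects with an `add V`-resolution have an `add V'`-resolution, where `V'` is
the sum of a syzygy of `V` and a projective generator. -/
theorem exists_syzygy_hasAddResolution
    (hG : ∀ X : C, ∃ K P : C, addClosure (fun X => X = G) P ∧ ShortExactSeq K P X) (V : C) :
    ∃ V' : C, addClosure (fun X => X = V') G ∧ ∀ (m : ℕ) (A : C), HasAddResolution V m A →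
      ∃ K P : C, addClosure (fun X => X = G) P ∧ ShortExactSeq K P A ∧
        HasAddResolution V' m K := by
  obtain ⟨S, Q, hQ, hS⟩ := hG V
  have hbase : ∀ A : C, addClosure (fun X => X = V) A →
      ∃ K P : C, addClosure (fun X => X = G) P ∧ ShortExactSeq K P A ∧
        addClosure (fun X => X = (S ⊞ G)) K := by
    intro A hA
    refine addClosure_le (Q := fun A => ∃ K P : C, addClosure (fun X => X = G) P ∧
      ShortExactSeq K P A ∧ addClosure (fun X => X = (S ⊞ G)) K) ?_ ?_ ?_ ?_ hA
    · intro X hX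
      exact ⟨X, X, addClosure_zero hX, .of_isZero_left hX (Iso.refl X), addClosure_zero hX⟩
    · rintro X Y ⟨K, P, h₁, h₂, h₃⟩ ⟨K', P', h₁', h₂', h₃'⟩
      exact ⟨_, _, addClosure_biprod h₁ h₁', h₂.biprod h₂', addClosure_biprod h₃ h₃'⟩
    · rintro X Y r ⟨K, P, h₁, h₂, h₃⟩
      obtain ⟨K', P', h₁', h₂'⟩ := hG X
      have := projective_of_addClosure_eq h₁
      have := projective_of_addClosure_eq h₁'
      -- A syzygy of a summand is a summand of a syzygy only up to a projective; this is why `G` is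
      -- added to `S`.
      obtain ⟨s⟩ := h₂'.retract_syzygy h₂ r
      exact ⟨K', P', h₁', h₂', addClosure_retract s
        (addClosure_biprod h₃ (addClosure_eq_biprod_right h₁'))⟩
    · rintro _ rfl
      exact ⟨S, Q, hQ, hS, addClosure_eq_biprod_left (addClosure_of rfl)⟩
  refine ⟨S ⊞ G, addClosure_eq_biprod_right (addClosure_of rfl), fun m => ?_⟩
  induction m with
  | zero => exact hbase
  | succ m ih =>
    intro A hA
    obtain ⟨K, U, hU, hK, hKres⟩ := hasAddResolution_succ_iff.1 hA
    obtain ⟨K', P, hP, hK', hK'res⟩ := ih K hKres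
    obtain ⟨U', P₀, hP₀, hU', hU'add⟩ := hbase U hU
    -- The syzygy `E` of `A` is an extension of `K` by `U'`. Rotating it against the cover `P` of
    -- `K` gives `0 ⟶ K' ⟶ U' ⊞ P ⟶ E ⟶ 0`, which preserves the length of the resolution.
    obtain ⟨E, hE, hE'⟩ := hU'.kernel_comp hK
    have := projective_of_addClosure_eq hP
    exact ⟨E, P₀, hP₀, hE, hasAddResolution_succ_iff.2 ⟨K', U' ⊞ P,
      addClosure_biprod hU'add (addClosure_eq_biprod_right hP), hE'.rotate hK', hK'res⟩⟩

/-- Each passage to a syzygy changes the resolving object. As only `N` passages are needed, a single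
finite sum contains all the objects that occur. -/
theorem exists_syzygiesHaveAddResolution
    (hG : ∀ X : C, ∃ K P : C, addClosure (fun X => X = G) P ∧ ShortExactSeq K P X)
    (m N : ℕ) (V : C) :
    ∃ V' : C, addClosure (fun X => X = V') V ∧ ∀ A : C, HasAddResolution V m A →
      SyzygiesHaveAddResolution V' m N A := by
  induction N generalizing V with
  | zero => exact ⟨V, addClosure_of rfl, fun _ _ => trivial⟩
  | succ N ih =>
    obtain ⟨V₁, hV₁, h₁⟩ := exists_syzygy_hasAddResolution hG V
    obtain ⟨V₂, hV₂, h₂⟩ := ih V₁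
    refine ⟨V ⊞ V₂, addClosure_eq_biprod_left (addClosure_of rfl), fun A hA => ?_⟩
    obtain ⟨K, P, hP, hK, hKres⟩ := h₁ m A hA
    have hV₁' := addClosure_eq_biprod_right (U := V) hV₂
    exact ⟨K, P, addClosure_mono (by
        rintro _ rfl
        exact addClosure_mono (by rintro _ rfl; exact hV₁') hV₁) hP,
      projective_of_addClosure_eq hP, hK, hasAddResolution_mono hV₁' m hKres,
      syzygiesHaveAddResolution_mono (addClosure_eq_biprod_right (addClosure_of rfl)) m N
        (h₂ K hKres)⟩

/-- If an exact functor `Z` sends projectives to objects of projective dimension at most one, then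
a syzygy of the image of a `t`-th syzygy is a `t + 1`-st syzygy of the image. -/
theorem isSyzygy_succ_map (Z : C ⥤ D) [Z.Additive] [PreservesFiniteLimits Z]
    [PreservesFiniteColimits Z]
    (hZ : ∀ Q : C, Projective Q → ∃ Q' P : D, Projective Q' ∧ Projective P ∧
      ShortExactSeq Q' P (Z.obj Q))
    (t : ℕ) {A K : C} (h : IsSyzygy t A K) {K' P : D} [Projective P]
    (h' : ShortExactSeq K' P (Z.obj K)) : IsSyzygy (t + 1) (Z.obj A) K' := by
  induction t generalizing K K' P with
  | zero =>
    obtain ⟨e⟩ := h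
    exact isSyzygy_succ_iff.2 ⟨Z.obj A, P, ⟨Iso.refl _⟩, inferInstance,
      h'.of_iso (Iso.refl _) (Iso.refl _) (Z.mapIso e)⟩
  | succ t ih =>
    obtain ⟨L, Q, h₁, h₂, h₃⟩ := isSyzygy_succ_iff.1 h
    obtain ⟨Q', P', _, _, hQ⟩ := hZ Q h₂
    -- Here `E` is a syzygy of `Z L`, handled by induction, and an extension of `Z K` by the
    -- projective `Q'`. Rotation turns the cover of `Z K` into a cover of `E` with the same kernel
    -- `K'`.
    obtain ⟨E, hE, hE'⟩ := hQ.kernel_comp (h₃.map Z)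
    exact isSyzygy_succ_iff.2 ⟨E, Q' ⊞ P, ih h₁ hE, inferInstance, hE'.rotate h'⟩

/-- Layers are restricted objects, whose `(t + 1)`-st syzygies are controlled by one object `V`. The
horseshoe lemma and the gluing of resolutions add `m + 1` to the length for every further layer. -/
theorem isIgusaTodorov_of_hasNilpotentLength {L : C ⥤ D} {Z : D ⥤ C} (η : 𝟭 C ⟶ L ⋙ Z)
    [∀ X, Epi (η.app X)] [Z.Additive] [PreservesFiniteLimits Z] [PreservesFiniteColimits Z]
    (hG : ∀ X : C, ∃ K P : C, addClosure (fun X => X = G) P ∧ ShortExactSeq K P X)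
    (hZ : ∀ Q : D, Projective Q → ∃ Q' P : C, Projective Q' ∧ Projective P ∧
      ShortExactSeq Q' P (Z.obj Q))
    {n : ℕ} (hn : 1 ≤ n) (hnil : ∀ X, HasNilpotentLength η n X) {m t : ℕ}
    (h : IsIgusaTodorov D m t) : IsIgusaTodorov C (n * (m + 1) - 1) (t + 1) := by
  obtain ⟨U, hU⟩ := h
  obtain ⟨V₀, -, hV₀⟩ := exists_syzygy_hasAddResolution hG (Z.obj U)
  -- Gluing on a layer needs as many of its syzygies as the length already built plus one, a number
  -- never exceeding `n * (m + 1)`.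
  obtain ⟨V, hV₀V, hV⟩ := exists_syzygiesHaveAddResolution hG m (n * (m + 1)) V₀
  have hZV : ∀ A : D, ∃ K : C, IsSyzygy (t + 1) (Z.obj A) K ∧ HasAddResolution V m K ∧
      SyzygiesHaveAddResolution V m (n * (m + 1)) K := by
    intro A
    obtain ⟨K, hK, hKres⟩ := hU A
    obtain ⟨K', P, hP, hK', hK'res⟩ := hV₀ m _ (hasAddResolution_map Z (addClosure_of rfl) m hKres)
    have := projective_of_addClosure_eq hP
    exact ⟨K', isSyzygy_succ_map Z hZ t hK hK', hasAddResolution_mono hV₀V m hK'res, hV _ hK'res⟩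
  have main : ∀ (k : ℕ) (_ : k < n) (X : C), HasNilpotentLength η (k + 1) X →
      ∃ K, IsSyzygy (t + 1) X K ∧ HasAddResolution V (k * (m + 1) + m) K := by
    intro k
    induction k with
    | zero =>
      intro _ X hX
      obtain ⟨e⟩ := (shortExactSeq_kernel_app η X).iso_of_isZero_left hX
      obtain ⟨K, h₁, h₂, -⟩ := hZV (L.obj X)
      exact ⟨K, isSyzygy_iso _ e.symm h₁, by simpa using h₂⟩
    | succ k ih =>
      intro hk X hX
      obtain ⟨K₁, h₁, h₁'⟩ := ih (Nat.lt_of_succ_lt hk) _ hX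
      obtain ⟨K₂, h₂, -, h₂'⟩ := hZV (L.obj X)
      obtain ⟨K, hK, hK'⟩ := exists_isSyzygy_of_shortExactSeq _ (shortExactSeq_kernel_app η X) h₁ h₂
      refine ⟨K, hK, ?_⟩
      rw [show (k + 1) * (m + 1) + m = k * (m + 1) + m + m + 1 by ring]
      refine hasAddResolution_of_shortExactSeq _ _ hK' h₁' (h₂'.of_le ?_)
      calc k * (m + 1) + m + 1 = (k + 1) * (m + 1) := by ring
        _ ≤ n * (m + 1) := Nat.mul_le_mul_right _ hk.le
  refine ⟨V, fun X => ?_⟩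
  obtain ⟨k, rfl⟩ : ∃ k, n = k + 1 := ⟨n - 1, by omega⟩
  obtain ⟨K, h₁, h₂⟩ := main k k.lt_succ_self X (hnil X)
  refine ⟨K, h₁, ?_⟩
  rwa [show (k + 1) * (m + 1) - 1 = k * (m + 1) + m by
    rw [add_mul, one_mul, ← add_assoc, Nat.add_sub_cancel]]

theorem igusaTodorovDistance_le_mul {L : C ⥤ D} {Z : D ⥤ C} (η : 𝟭 C ⟶ L ⋙ Z)
    [∀ X, Epi (η.app X)] [Z.Additive] [PreservesFiniteLimits Z] [PreservesFiniteColimits Z]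
    (hG : ∀ X : C, ∃ K P : C, addClosure (fun X => X = G) P ∧ ShortExactSeq K P X)
    (hZ : ∀ Q : D, Projective Q → ∃ Q' P : C, Projective Q' ∧ Projective P ∧
      ShortExactSeq Q' P (Z.obj Q))
    {n : ℕ} (hn : 1 ≤ n) (hnil : ∀ X, HasNilpotentLength η n X) :
    igusaTodorovDistance C ≤ n * (igusaTodorovDistance D + 1) - 1 :=
  iInf_natCast_le_mul hn fun _ ⟨t, ht⟩ =>
    ⟨t + 1, isIgusaTodorov_of_hasNilpotentLength η hG hZ hn hnil ht⟩

end IgusaTodorov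

/-! ### Thick powers and the Rouquier dimension. -/

section RouquierDimension

universe v v' u'

theorem thickOne_map {T : Type u} [Category.{v} T] [HasShift T ℤ] [Preadditive T]
    {T' : Type u'} [Category.{v'} T'] [HasShift T' ℤ] [Preadditive T'] (F : T ⥤ T') [F.CommShift ℤ] [F.Additive] {P : ObjectProperty T}
    {Q : ObjectProperty T'} (h : ∀ X, P X → thickOne Q (F.obj X)) {X : T} (hX : thickOne P X) :
    thickOne Q (F.obj X) := by
  induction hX with
  | of X hX => exact h X hX
  | zero X hX => exact thickOne.zero _ (F.map_isZero hX)
  | directSum X Y S inl fst inr snd h₁ h₂ h hX hY ihX ihY =>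
    refine thickOne.directSum _ _ _ (F.map inl) (F.map fst) (F.map inr) (F.map snd) ?_ ?_ ?_ ihX ihY
    · rw [← F.map_comp, h₁, F.map_id]
    · rw [← F.map_comp, h₂, F.map_id]
    · rw [← F.map_comp, ← F.map_comp, ← F.map_add, h, F.map_id]
  | summand X Y r hY ih => exact thickOne.summand _ _ (r.map F) ih
  | shift X n hX ih =>
    exact thickOne.summand _ _ (Retract.ofIso ((F.commShiftIso n).app X)) (thickOne.shift _ n ih)

variable {T : Type u} [Category.{v} T] [HasZeroObject T] [HasShift T ℤ] [Preadditive T]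
  [∀ n : ℤ, (shiftFunctor T n).Additive] [Pretriangulated T]
  {T' : Type u'} [Category.{v'} T'] [HasZeroObject T'] [HasShift T' ℤ] [Preadditive T']
  [∀ n : ℤ, (shiftFunctor T' n).Additive] [Pretriangulated T']

/-- This gives access to the associativity of `ObjectProperty.extensionProduct`, a consequence of
the octahedral axiom. -/
theorem triangleProduct_eq (P Q : ObjectProperty T) :
    triangleProduct P Q = P.extensionProduct Q := by
  ext A
  constructor
  · rintro ⟨X, Y, f, g, h, hX, hY, hT⟩
    exact ⟨X, Y, f, g, h, hT, hX, hY⟩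
  · rintro ⟨X, Y, f, g, h, hT, hX, hY⟩
    exact ⟨X, Y, f, g, h, hX, hY, hT⟩

/-- Binary sums are written as products over `Bool` to match `productTriangle_distinguished`. -/
theorem thickOne_pi {P : ObjectProperty T} (f : Bool → T) (h : ∀ b, thickOne P (f b)) :
    thickOne P (∏ᶜ f) := by
  refine thickOne.summand _ (⨁ f) (Retract.ofIso (biproduct.isoProduct f).symm)
    (thickOne.directSum (f true) (f false) _ (biproduct.ι f true) (biproduct.π f true)
      (biproduct.ι f false) (biproduct.π f false) (by simp) (by simp) ?_ (h _) (h _))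
  rw [← biproduct.total, Fintype.sum_bool]

/-- If `P` contains a zero object and is stable under shifts and binary products, then `⟨P⟩_1`
consists of the retracts of objects of `P`. -/
theorem exists_retract_of_thickOne {P : ObjectProperty T} (hzero : ∀ X, IsZero X → P X)
    (hshift : ∀ X (n : ℤ), P X → P (X⟦n⟧))
    (hprod : ∀ f : Bool → T, (∀ b, P (f b)) → P (∏ᶜ f)) {X : T} (hX : thickOne P X) :
    ∃ Y, P Y ∧ Nonempty (Retract X Y) := by
  induction hX with
  | of X hX => exact ⟨X, hX, ⟨Retract.refl X⟩⟩
  | zero X hX => exact ⟨X, hzero X hX, ⟨Retract.refl X⟩⟩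
  | directSum X Y S inl fst inr snd h₁ h₂ h hX hY ihX ihY =>
    obtain ⟨A, hA, ⟨r⟩⟩ := ihX
    obtain ⟨B, hB, ⟨s⟩⟩ := ihY
    let f : Bool → T := fun b => cond b A B
    let i : ∀ b, S ⟶ f b
      | true => fst ≫ r.i
      | false => snd ≫ s.i
    have h₃ : Pi.lift i ≫ Pi.π f true = fst ≫ r.i := Pi.lift_π i true
    have h₄ : Pi.lift i ≫ Pi.π f false = snd ≫ s.i := Pi.lift_π i false
    refine ⟨∏ᶜ f, hprod f (by rintro (_ | _) <;> assumption),
      ⟨⟨Pi.lift i, Pi.π f true ≫ r.r ≫ inl + Pi.π f false ≫ s.r ≫ inr, ?_⟩⟩⟩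
    rw [Preadditive.comp_add, reassoc_of% h₃, reassoc_of% h₄, r.retract_assoc, s.retract_assoc, h]
  | summand X Y r hY ih =>
    obtain ⟨A, hA, ⟨s⟩⟩ := ih
    exact ⟨A, hA, ⟨r.trans s⟩⟩
  | shift X n hX ih =>
    obtain ⟨A, hA, ⟨s⟩⟩ := ih
    exact ⟨A⟦n⟧, hshift A n hA, ⟨s.map (shiftFunctor T n)⟩⟩

theorem thickPower_isZero {P : ObjectProperty T} (n : ℕ) {X : T} (h : IsZero X) :
    thickPower P n X := by
  cases n with
  | zero => exact h
  | succ n => exact thickOne.zero X h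

theorem thickPower_retract {P : ObjectProperty T} (n : ℕ) {X Y : T} (r : Retract X Y)
    (h : thickPower P n Y) : thickPower P n X := by
  cases n with
  | zero => exact (IsZero.iff_id_eq_zero _).2 (by
      rw [← r.retract, IsZero.eq_of_tgt h r.i 0, zero_comp])
  | succ n => exact thickOne.summand X Y r h

theorem thickPower_shift {P : ObjectProperty T} (n : ℕ) (X : T) (a : ℤ)
    (h : thickPower P n X) : thickPower P n (X⟦a⟧) := by
  cases n with
  | zero => exact (shiftFunctor T a).map_isZero h
  | succ n => exact thickOne.shift X a h

theorem thickPower_pi {P : ObjectProperty T} (n : ℕ) (f : Bool → T)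
    (h : ∀ b, thickPower P n (f b)) : thickPower P n (∏ᶜ f) := by
  cases n with
  | zero =>
    refine (IsZero.iff_id_eq_zero _).2 (Pi.hom_ext _ _ fun b => ?_)
    exact IsZero.eq_of_tgt (h b) _ _
  | succ n => exact thickOne_pi f h

/-- Distinguished triangles are stable under shifts and finite products, so of the closure
operations in `thickOne` only retracts remain to be taken. -/
theorem thickPower_succ {P : ObjectProperty T} (n : ℕ) :
    thickPower P (n + 1) =
      (ObjectProperty.extensionProduct (thickOne P) (thickPower P n)).retractClosure := by
  ext X
  constructor
  · intro hX
    change thickOne (triangleProduct _ _) X at hX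
    rw [triangleProduct_eq] at hX
    refine (exists_retract_of_thickOne ?_ ?_ ?_ hX).imp fun Y ⟨hY, r⟩ => ⟨hY, r⟩
    · intro X hX
      exact ⟨X, 0, _, _, _, contractible_distinguished X, thickOne.zero _ hX,
        thickPower_isZero n (isZero_zero T)⟩
    · rintro A a ⟨X, Y, f, g, h, hT, hX, hY⟩
      exact ⟨_, _, _, _, _, Triangle.shift_distinguished _ hT a, thickOne.shift X a hX,
        thickPower_shift n Y a hY⟩
    · intro A hA
      choose X Y f g h hT hX hY using hA
      exact ⟨_, _, _, _, _, productTriangle_distinguished _ hT, thickOne_pi X hX,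
        thickPower_pi n Y hY⟩
  · rintro ⟨Y, hY, ⟨r⟩⟩
    rw [← triangleProduct_eq] at hY
    exact thickOne.summand X Y r (thickOne.of Y hY)

theorem thickPower_add [IsTriangulated T] {P : ObjectProperty T} (a b : ℕ) :
    ObjectProperty.extensionProduct (thickPower P a) (thickPower P b) ≤ thickPower P (a + b) := by
  induction a with
  | zero =>
    rintro A ⟨X, Y, f, g, h, hT, hX, hY⟩
    have : IsIso g := (Triangle.isZero₁_iff_isIso₂ _ hT).1 hX
    rw [zero_add]
    exact thickPower_retract b (Retract.ofIso (asIso g)) hY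
  | succ a ih =>
    rw [show a + 1 + b = a + b + 1 by ring, thickPower_succ, thickPower_succ]
    -- Retract closures are pulled out of the product; associativity then moves the first factor
    -- aside so that induction applies.
    refine (ObjectProperty.monotone_extensionProduct_right _
      (ObjectProperty.le_retractClosure _)).trans
      ((ObjectProperty.extensionProduct_retractClosure_retractClosure_le _ _).trans
      (ObjectProperty.monotone_retractClosure ?_))
    rw [ObjectProperty.extensionProduct_assoc]
    exact ObjectProperty.monotone_extensionProduct_right _ ih

theorem thickPower_map (F : T ⥤ T') [F.CommShift ℤ] [F.IsTriangulated] {P : ObjectProperty T}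
    {Q : ObjectProperty T'} (h : ∀ X, P X → thickOne Q (F.obj X)) (n : ℕ) {X : T}
    (hX : thickPower P n X) : thickPower Q n (F.obj X) := by
  induction n generalizing X with
  | zero => exact F.map_isZero hX
  | succ n ih =>
    refine thickOne_map F ?_ hX
    rintro A ⟨X, Y, f, g, k, hX, hY, hT⟩
    exact thickOne.of _ ⟨_, _, _, _, _, thickOne_map F h hX, ih hY, F.map_distinguished _ hT⟩

/-- An essentially surjective triangulated functor does not increase the Rouquier dimension. -/
theorem rouquierDimension_le_of_essSurj (F : T ⥤ T') [F.CommShift ℤ] [F.IsTriangulated]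
    [F.EssSurj] : rouquierDimension T' ≤ rouquierDimension T := by
  refine iInf_natCast_le_of_imp ?_
  rintro m ⟨G, hG⟩
  refine ⟨F.obj G, fun A => thickPower_retract _ (Retract.ofIso (F.objObjPreimageIso A).symm)
    (thickPower_map F ?_ _ (hG (F.objPreimage A)))⟩
  rintro _ rfl
  exact thickOne.of _ rfl

/-- A distinguished triangle between objects of a triangulated subcategory is distinguished
there. -/
theorem extensionProduct_fullSubcategory {P : ObjectProperty T} [P.IsTriangulated]
    {X A Y : P.FullSubcategory} {f : X.obj ⟶ A.obj} {g : A.obj ⟶ Y.obj}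
    {h : Y.obj ⟶ X.obj⟦(1 : ℤ)⟧} (hT : Triangle.mk f g h ∈ distTriang T) :
    ∃ (f' : X ⟶ A) (g' : A ⟶ Y) (h' : Y ⟶ X⟦(1 : ℤ)⟧),
      Triangle.mk f' g' h' ∈ distTriang P.FullSubcategory :=
  ⟨P.fullyFaithfulι.preimage f, P.fullyFaithfulι.preimage g,
    P.fullyFaithfulι.preimage (h ≫ (P.ι.commShiftIso (1 : ℤ)).inv.app X),
    isomorphic_distinguished _ hT _ (Triangle.isoMk _ _ (Iso.refl _) (Iso.refl _) (Iso.refl _)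
      ((Category.comp_id _).trans (Category.id_comp _).symm)
      ((Category.comp_id _).trans (Category.id_comp _).symm) (by
        have h₁ : P.ι.map (P.fullyFaithfulι.preimage (h ≫ (P.ι.commShiftIso (1 : ℤ)).inv.app X)) ≫
            (P.ι.commShiftIso (1 : ℤ)).hom.app X = h := by simp
        refine Eq.trans ?_ (h₁.trans (Category.id_comp h).symm)
        refine (congrArg (_ ≫ ·) ((shiftFunctor T (1 : ℤ)).map_id _)).trans ?_
        exact Category.comp_id _))⟩

end RouquierDimension

/-! ### Bounded derived categories through strictly bounded complexes. -/

section BoundedDerivedCategory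

universe v w' v' u'

open DerivedCategory DerivedCategory.TStructure

variable {C : Type u} [Category.{v} C] [Abelian C] [HasDerivedCategory.{w} C]
  {D : Type u'} [Category.{v'} D] [Abelian D] [HasDerivedCategory.{w'} D]

/-- The complex is strictly bounded. -/
def IsStrictlyBounded {C : Type u} [Category.{v} C] [Abelian C] (K : CochainComplex C ℤ) : Prop :=
  ∃ a b : ℤ, ∀ i : ℤ, i < a ∨ b < i → IsZero (K.X i)

theorem bounded_Q_obj {K : CochainComplex C ℤ} (hK : IsStrictlyBounded K) :
    (t : Triangulated.TStructure (DerivedCategory C)).bounded (Q.obj K) := by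
  obtain ⟨a, b, h⟩ := hK
  exact ⟨⟨a, K, Iso.refl _, (K.isStrictlyGE_iff a).2 fun i hi => h i (Or.inl hi)⟩,
    ⟨b, K, Iso.refl _, (K.isStrictlyLE_iff b).2 fun i hi => h i (Or.inr hi)⟩⟩

/-- A strictly bounded complex, as an object of the bounded derived category. -/
noncomputable def boundedQ (K : CochainComplex C ℤ) (hK : IsStrictlyBounded K) : Bounded C :=
  ⟨Q.obj K, bounded_Q_obj hK⟩

/-- Objects of the bounded derived category are thereby replaced by honest complexes, to which
functors can be applied degreewise. -/
theorem exists_iso_boundedQ (X : Bounded C) :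
    ∃ (K : CochainComplex C ℤ) (hK : IsStrictlyBounded K), Nonempty (X ≅ boundedQ K hK) := by
  obtain ⟨⟨a, ha⟩, ⟨b, hb⟩⟩ := X.property
  obtain ⟨K, h₁, h₂, ⟨e⟩⟩ := exists_iso_Q_obj_of_isGE_of_isLE X.obj a b
  refine ⟨K, ⟨a, b, ?_⟩, ⟨(t : Triangulated.TStructure (DerivedCategory C)).bounded.isoMk e⟩⟩
  rintro i (hi | hi)
  · exact K.isZero_of_isStrictlyGE a i hi
  · exact K.isZero_of_isStrictlyLE b i hi

theorem IsStrictlyBounded.map {C : Type u} [Category.{v} C] [Abelian C] {D : Type u'}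
    [Category.{v'} D] [Abelian D] (F : C ⥤ D) [F.Additive] {K : CochainComplex C ℤ}
    (hK : IsStrictlyBounded K) :
    IsStrictlyBounded ((F.mapHomologicalComplex (ComplexShape.up ℤ)).obj K) := by
  obtain ⟨a, b, h⟩ := hK
  exact ⟨a, b, fun i hi => F.map_isZero (h i hi)⟩

variable (F : C ⥤ D) [F.Additive] [PreservesFiniteLimits F] [PreservesFiniteColimits F]

theorem bounded_mapDerivedCategory (X : Bounded C) :
    (t : Triangulated.TStructure (DerivedCategory D)).bounded
      ((Bounded.ι ⋙ F.mapDerivedCategory).obj X) := by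
  obtain ⟨K, hK, ⟨e⟩⟩ := exists_iso_boundedQ X
  exact ObjectProperty.prop_of_iso _ ((Bounded.ι ⋙ F.mapDerivedCategory).mapIso e ≪≫
    F.mapDerivedCategoryFactors.app K).symm (bounded_Q_obj (hK.map F))

/-- The functor between bounded derived categories induced by an exact functor. -/
noncomputable def mapBoundedDerived : Bounded C ⥤ Bounded D :=
  (t : Triangulated.TStructure (DerivedCategory D)).bounded.lift (Bounded.ι ⋙ F.mapDerivedCategory)
    (bounded_mapDerivedCategory F)

noncomputable instance : (mapBoundedDerived F).CommShift ℤ :=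
  inferInstanceAs ((t : Triangulated.TStructure (DerivedCategory D)).bounded.lift
    (Bounded.ι ⋙ F.mapDerivedCategory) (bounded_mapDerivedCategory F) |>.CommShift ℤ)

instance : (mapBoundedDerived F).IsTriangulated :=
  inferInstanceAs ((t : Triangulated.TStructure (DerivedCategory D)).bounded.lift
    (Bounded.ι ⋙ F.mapDerivedCategory) (bounded_mapDerivedCategory F) |>.IsTriangulated)

/-- The induced functor applies the exact functor termwise. -/
noncomputable def mapBoundedDerivedIso (K : CochainComplex C ℤ) (hK : IsStrictlyBounded K) :
    (mapBoundedDerived F).obj (boundedQ K hK) ≅ boundedQ _ (hK.map F) :=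
  (t : Triangulated.TStructure (DerivedCategory D)).bounded.isoMk
    (F.mapDerivedCategoryFactors.app K)

noncomputable def boundedQIso {K L : CochainComplex C ℤ} (e : K ≅ L) (hK : IsStrictlyBounded K)
    (hL : IsStrictlyBounded L) : boundedQ K hK ≅ boundedQ L hL :=
  (t : Triangulated.TStructure (DerivedCategory C)).bounded.isoMk (Q.mapIso e)

/-- If an exact functor has a section, it does not increase the Rouquier dimension of the bounded
derived category. -/
theorem rouquierDimension_bounded_le_of_section (Z : D ⥤ C) [Z.Additive] (e : Z ⋙ F ≅ 𝟭 D) :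
    rouquierDimension (Bounded D) ≤ rouquierDimension (Bounded C) := by
  -- A preimage of a represented object is obtained by applying `Z` to each term of the complex;
  -- additivity of `Z` suffices, because `Z` acts on complexes and not on derived categories.
  have : (mapBoundedDerived F).EssSurj := by
    refine ⟨fun X => ?_⟩
    obtain ⟨K, hK, ⟨e'⟩⟩ := exists_iso_boundedQ X
    let i : (F.mapHomologicalComplex (ComplexShape.up ℤ)).obj
        ((Z.mapHomologicalComplex (ComplexShape.up ℤ)).obj K) ≅ K :=
      (NatIso.mapHomologicalComplex e (ComplexShape.up ℤ)).app K ≪≫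
        (Functor.mapHomologicalComplexIdIso D (ComplexShape.up ℤ)).app K
    exact ⟨boundedQ _ (hK.map Z), ⟨mapBoundedDerivedIso F _ (hK.map Z) ≪≫
      boundedQIso i ((hK.map Z).map F) hK ≪≫ e'.symm⟩⟩
  exact rouquierDimension_le_of_essSurj (mapBoundedDerived F)

theorem exists_distTriang_boundedQ {S : ShortComplex (CochainComplex C ℤ)} (hS : S.ShortExact)
    (h₁ : IsStrictlyBounded S.X₁) (h₂ : IsStrictlyBounded S.X₂) (h₃ : IsStrictlyBounded S.X₃) :
    ∃ (f : boundedQ S.X₁ h₁ ⟶ boundedQ S.X₂ h₂) (g : boundedQ S.X₂ h₂ ⟶ boundedQ S.X₃ h₃)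
      (h : boundedQ S.X₃ h₃ ⟶ (boundedQ S.X₁ h₁)⟦(1 : ℤ)⟧),
      Triangle.mk f g h ∈ distTriang (Bounded C) :=
  extensionProduct_fullSubcategory (X := boundedQ S.X₁ h₁) (A := boundedQ S.X₂ h₂)
    (Y := boundedQ S.X₃ h₃) (triangleOfSES_distinguished hS)

end BoundedDerivedCategory

/-! ### Degreewise filtrations of bounded complexes. -/

section NilpotentLengthComplex

universe v w' v' u'

open DerivedCategory

/-- Needed because the kernel of a chain map is computed degreewise only up to isomorphism. -/
theorem hasNilpotentLength_iso {A : Type u} [Category.{v} A] {B : Type u'} [Category.{v'} B]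
    [Abelian B] {L : B ⥤ A} {Z : A ⥤ B} (η : 𝟭 B ⟶ L ⋙ Z) (k : ℕ) {X Y : B} (e : X ≅ Y)
    (hX : HasNilpotentLength η k X) : HasNilpotentLength η k Y := by
  induction k generalizing X Y with
  | zero => exact IsZero.of_iso hX e.symm
  | succ k ih =>
    exact ih (kernel.mapIso (η.app X) (η.app Y) e ((L ⋙ Z).mapIso e) (η.naturality e.hom).symm) hX

variable {A : Type u} [Category.{v} A] [Abelian A] [HasDerivedCategory.{w} A]
  {B : Type u'} [Category.{v'} B] [Abelian B] [HasDerivedCategory.{w'} B]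
  {L : B ⥤ A} {Z : A ⥤ B} (η : 𝟭 B ⟶ L ⋙ Z) [∀ X, Epi (η.app X)]
  [L.Additive] [Z.Additive] [PreservesFiniteLimits Z] [PreservesFiniteColimits Z]

/-- The filtration is formed in the category of complexes, where the additive functor `L` acts
termwise without being exact. Only `Z`, which is exact, has to act on derived categories. -/
theorem thickPower_boundedQ {T : Bounded A} {m : ℕ}
    (hT : ∀ X, thickPower (fun X => X = T) m X) (k : ℕ) (K : CochainComplex B ℤ)
    (hK : IsStrictlyBounded K) (hnil : ∀ i, HasNilpotentLength η k (K.X i)) :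
    thickPower (fun X => X = (mapBoundedDerived Z).obj T) (k * m) (boundedQ K hK) := by
  induction k generalizing K with
  | zero =>
    have hzero : IsZero K := (IsZero.iff_id_eq_zero _).2 (by
      ext i
      exact (hnil i : IsZero (K.X i)).eq_of_src _ _)
    rw [zero_mul]
    refine (IsZero.iff_id_eq_zero _).2 ?_
    ext
    exact (Q.map_isZero hzero).eq_of_src _ _
  | succ k ih =>
    let M := (L.mapHomologicalComplex (ComplexShape.up ℤ)).obj K
    let N := (Z.mapHomologicalComplex (ComplexShape.up ℤ)).obj M
    -- This is `η` in each degree, hence an epimorphism of complexes whose kernel has nilpotent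
    -- length `k` in each degree.
    let f : K ⟶ N := (Functor.mapHomologicalComplexIdIso B (ComplexShape.up ℤ)).inv.app K ≫
      (NatTrans.mapHomologicalComplex η (ComplexShape.up ℤ)).app K
    have hf : ∀ i, f.f i = η.app (K.X i) := fun i => Category.id_comp _
    have : ∀ i, Epi (f.f i) := fun i => by
      rw [hf]
      exact (inferInstance : ∀ X, Epi (η.app X)) _
    have : Epi f := HomologicalComplex.epi_of_epi_f f inferInstance
    have hker : ∀ i, Nonempty ((kernel f).X i ≅ kernel (η.app (K.X i))) := fun i =>
      ⟨PreservesKernel.iso (HomologicalComplex.eval B (ComplexShape.up ℤ) i) f ≪≫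
        kernelIsoOfEq (hf i)⟩
    have hb : IsStrictlyBounded (kernel f) := by
      obtain ⟨a, b, h⟩ := hK
      refine ⟨a, b, fun i hi => ?_⟩
      obtain ⟨e⟩ := hker i
      refine IsZero.of_iso ?_ e
      exact (IsZero.iff_id_eq_zero _).2 (by
        rw [← cancel_mono (kernel.ι _)]
        exact (h i hi).eq_of_tgt _ _)
    obtain ⟨a, b, c, hT'⟩ := exists_distTriang_boundedQ
      (S := ShortComplex.mk (kernel.ι f) f (kernel.condition f))
      (shortExact_of_lift _ _ _ fun g hg => ⟨kernel.lift f g hg, by simp⟩) hb hK ((hK.map L).map Z)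
    rw [add_mul, one_mul]
    refine thickPower_add (k * m) m _ ⟨_, _, a, b, c, hT', ih _ hb fun i => ?_, ?_⟩
    · obtain ⟨e⟩ := hker i
      exact hasNilpotentLength_iso η k e.symm (hnil i)
    · refine thickPower_retract m (Retract.ofIso (mapBoundedDerivedIso Z M (hK.map L)).symm)
        (thickPower_map (mapBoundedDerived Z) ?_ m (hT _))
      rintro _ rfl
      exact thickOne.of _ rfl

theorem rouquierDimension_bounded_le_mul {n : ℕ} (hn : 1 ≤ n)
    (hnil : ∀ X, HasNilpotentLength η n X) :
    rouquierDimension (Bounded B) ≤ n * (rouquierDimension (Bounded A) + 1) - 1 := by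
  refine iInf_natCast_le_mul hn ?_
  rintro m ⟨T, hT⟩
  refine ⟨(mapBoundedDerived Z).obj T, fun X => ?_⟩
  rw [Nat.sub_add_cancel (Nat.mul_pos hn m.succ_pos)]
  obtain ⟨K, hK, ⟨e⟩⟩ := exists_iso_boundedQ X
  exact thickPower_retract _ (Retract.ofIso e)
    (thickPower_boundedQ η hT n K hK fun i => hnil _)

end NilpotentLengthComplex

/-! ### Finitely generated modules and restriction of scalars. -/

section FinitelyGeneratedModules

attribute [local instance] Abelian.hasFiniteBiproducts

theorem epi_of_surjective_fgModuleCat {A : Type u} [Ring A]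
    {X Y : FGModuleCat.{u} A} (f : X ⟶ Y)
    (hf : Function.Surjective f.hom.hom) : Epi f :=
  ⟨fun g h w => by
    ext x
    obtain ⟨y, rfl⟩ := hf x
    exact congr($(w).hom.hom y)⟩

/-- `B` is a finitely generated module along the ring homomorphism `f : A →+* B`. -/
abbrev IsFiniteAlong {A B : Type u} [Ring A] [Ring B] (f : A →+* B) : Prop :=
  Module.Finite A ((ModuleCat.restrictScalars.{u} f).obj (ModuleCat.of B B))

theorem finite_restrictScalars {A B : Type u} [Ring A] [Ring B] {f : A →+* B} (hf : IsFiniteAlong f) (X : ModuleCat.{u} B)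
    [Module.Finite B X] : Module.Finite A ((ModuleCat.restrictScalars.{u} f).obj X) := by
  let : Module A B := Module.compHom B f
  let : Module A X := Module.compHom X f
  have : IsScalarTower A B X := ⟨fun a b x => mul_smul (f a) b x⟩
  have : Module.Finite A B := hf
  exact (Module.Finite.trans B X : Module.Finite A X)

/-- The section makes `π` surjective, so `1` generates `A` over `B`. -/
theorem isFiniteAlong_of_section {A B : Type u} [Ring A] [Ring B] {ι : A →+* B} {π : B →+* A}
    (hπι : π.comp ι = RingHom.id A) : IsFiniteAlong π := by
  refine ⟨⟨{(1 : A)}, (Submodule.eq_top_iff'.2 fun a => ?_)⟩⟩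
  have h : ι a • (show (ModuleCat.restrictScalars.{u} π).obj (ModuleCat.of A A) from (1 : A)) =
      (show A from a) := by
    change π (ι a) * 1 = a
    rw [mul_one]
    exact congr($hπι a)
  rw [← show _ = (show A from a) from h]
  exact Submodule.smul_mem _ _ (Submodule.subset_span (Finset.mem_singleton_self _))

variable {A : Type u} [Ring A] [IsNoetherianRing A]

theorem surjective_of_epi_fgModuleCat {X Y : FGModuleCat.{u} A} (f : X ⟶ Y) [Epi f] :
    Function.Surjective f.hom.hom :=
  (ModuleCat.epi_iff_surjective _).1
    (inferInstance : Epi ((forget₂ (FGModuleCat.{u} A) (ModuleCat.{u} A)).map f))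

theorem projective_fgModuleCat (X : FGModuleCat.{u} A) [Module.Projective A X] :
    Projective X where
  factors {E Y} f e _ := by
    obtain ⟨h, hh⟩ := Module.projective_lifting_property e.hom.hom f.hom.hom
      (surjective_of_epi_fgModuleCat e)
    exact ⟨FGModuleCat.ofHom h, by ext x; exact congr($hh x)⟩

variable (A) in
theorem addClosure_fgModuleCat_free (k : ℕ) :
    addClosure (fun X => X = FGModuleCat.of.{u} A A) (FGModuleCat.of A (Fin k → A)) := by
  refine addClosure_of_finite (fun _ : Fin k => FGModuleCat.of.{u} A A) (fun _ => rfl)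
    ⟨biproduct.lift fun j => FGModuleCat.ofHom (LinearMap.proj j),
      biproduct.desc fun j => FGModuleCat.ofHom (LinearMap.single A (fun _ => A) j), ?_⟩
  rw [biproduct.lift_desc]
  refine FGModuleCat.hom_ext (LinearMap.ext fun x => ?_)
  have : ∀ (s : Finset (Fin k)) (g : Fin k → (FGModuleCat.of A (Fin k → A) ⟶
      FGModuleCat.of A (Fin k → A))), (∑ j ∈ s, g j).hom.hom x = ∑ j ∈ s, (g j).hom.hom x := by
    classical
    intro s g
    induction s using Finset.induction_on with
    | empty => rfl
    | insert j s hj ih =>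
      rw [Finset.sum_insert hj, Finset.sum_insert hj, ← ih]
      rfl
  rw [this]
  exact Finset.univ_sum_single x

/-- This provides the projective generator required by the syzygy arguments: the regular module. -/
theorem exists_shortExactSeq_fgModuleCat (X : FGModuleCat.{u} A) :
    ∃ K P : FGModuleCat.{u} A, addClosure (fun X => X = FGModuleCat.of.{u} A A) P ∧
      ShortExactSeq K P X := by
  obtain ⟨k, f, hf⟩ := Module.Finite.exists_fin' A X
  let p : FGModuleCat.of.{u} A (Fin k → A) ⟶ X := FGModuleCat.ofHom f
  have : Epi p := epi_of_surjective_fgModuleCat p hf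
  exact ⟨_, _, addClosure_fgModuleCat_free A k, shortExactSeq_kernel p⟩

theorem addClosure_of_projective_fgModuleCat (X : FGModuleCat.{u} A) (hX : Projective X) :
    addClosure (fun X => X = FGModuleCat.of.{u} A A) X := by
  obtain ⟨K, P, hP, i, p, w, h⟩ := exists_shortExactSeq_fgModuleCat X
  have : Epi p := h.epi_g
  exact addClosure_retract ⟨Projective.factorThru (𝟙 X) p, p, Projective.factorThru_comp _ _⟩ hP

variable {B : Type u} [Ring B] [IsNoetherianRing B]

instance preservesFiniteLimits_restrictScalars (f : A →+* B) :
    PreservesFiniteLimits (ModuleCat.restrictScalars.{u} f) :=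
  ⟨fun _ _ _ => ⟨inferInstance⟩⟩

/-- Restriction of scalars between categories of finitely generated modules. -/
noncomputable def fgRestrict (f : A →+* B) (hf : IsFiniteAlong f) :
    FGModuleCat.{u} B ⥤ FGModuleCat.{u} A :=
  (ModuleCat.isFG.{u} A).lift
    (forget₂ (FGModuleCat.{u} B) (ModuleCat.{u} B) ⋙ ModuleCat.restrictScalars.{u} f) fun X =>
      finite_restrictScalars hf X.obj

variable (f : A →+* B) (hf : IsFiniteAlong f)

noncomputable def fgRestrictCompForget :
    fgRestrict f hf ⋙ forget₂ (FGModuleCat.{u} A) (ModuleCat.{u} A) ≅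
      forget₂ (FGModuleCat.{u} B) (ModuleCat.{u} B) ⋙ ModuleCat.restrictScalars.{u} f :=
  Iso.refl _

instance : (fgRestrict f hf).Additive where
  map_add := rfl

instance : PreservesFiniteLimits (fgRestrict f hf) :=
  have : PreservesFiniteLimits
      (fgRestrict f hf ⋙ forget₂ (FGModuleCat.{u} A) (ModuleCat.{u} A)) :=
    preservesFiniteLimits_of_natIso (fgRestrictCompForget f hf).symm
  preservesFiniteLimits_of_reflects_of_preserves _
    (forget₂ (FGModuleCat.{u} A) (ModuleCat.{u} A))

instance : PreservesFiniteColimits (fgRestrict f hf) :=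
  have : PreservesFiniteColimits
      (fgRestrict f hf ⋙ forget₂ (FGModuleCat.{u} A) (ModuleCat.{u} A)) :=
    preservesFiniteColimits_of_natIso (fgRestrictCompForget f hf).symm
  preservesFiniteColimits_of_reflects_of_preserves _
    (forget₂ (FGModuleCat.{u} A) (ModuleCat.{u} A))

/-- Projectives are summands of finite free modules, so only the regular module has to be checked.
-/
theorem preservesProjectiveObjects_fgRestrict
    (h : Module.Projective A ((ModuleCat.restrictScalars.{u} f).obj (ModuleCat.of B B))) :
    (fgRestrict f hf).PreservesProjectiveObjects where
  projective_obj {X} hX := by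
    have : Module.Projective A ((fgRestrict f hf).obj (FGModuleCat.of.{u} B B)) := h
    have : Projective ((fgRestrict f hf).obj (FGModuleCat.of.{u} B B)) :=
      projective_fgModuleCat _
    refine projective_of_addClosure_eq (G := (fgRestrict f hf).obj (FGModuleCat.of.{u} B B))
      (addClosure_map _ ?_ (addClosure_of_projective_fgModuleCat X hX))
    rintro _ rfl
    exact addClosure_of rfl

end FinitelyGeneratedModules

/-! ### Restriction along the two maps of a split ring extension. -/

section SplitExtension

attribute [local instance] Abelian.hasFiniteBiproducts

variable {A B : Type u} [Ring A] [Ring B] [IsNoetherianRing A] [IsNoetherianRing B]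
  (ι : A →+* B) (π : B →+* A) (hπι : π.comp ι = RingHom.id A) (hι : IsFiniteAlong ι)

/-- Restriction along a section followed by restriction along the projection. -/
noncomputable def fgRestrictCompIso (hπ : IsFiniteAlong π) :
    fgRestrict π hπ ⋙ fgRestrict ι hι ≅ 𝟭 (FGModuleCat.{u} A) :=
  NatIso.ofComponents (fun X => (ModuleCat.isFG.{u} A).isoMk
    ((ModuleCat.restrictScalarsComp'App ι π _ hπι.symm X.obj).symm ≪≫
      ModuleCat.restrictScalarsId'App _ rfl X.obj)) (fun _ => rfl)

end SplitExtension

/-! ### Reduction modulo an ideal. -/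

section QuotientByIdeal

variable {B : Type u} [Ring B] (I : Ideal B)

/-- The functor `X ↦ X / I X`. -/
noncomputable def fgQuotient : FGModuleCat.{u} B ⥤ FGModuleCat.{u} B where
  obj X := FGModuleCat.of B (X ⧸ I • (⊤ : Submodule B X))
  map {X Y} f := FGModuleCat.ofHom (Submodule.mapQ _ _ f.hom.hom (by
    rw [← Submodule.map_le_iff_le_comap, Submodule.map_smul'']
    exact Submodule.smul_mono le_rfl le_top))
  map_id X := by
    ext x
    rfl
  map_comp f g := by
    ext x
    rfl

instance : (fgQuotient I).Additive where
  map_add {X Y f g} := by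
    ext x
    obtain ⟨x, rfl⟩ := Submodule.Quotient.mk_surjective _ x
    rfl

end QuotientByIdeal

/-! ### Split extensions with nilpotent kernel. -/

section SplitExtension

attribute [local instance] Abelian.hasFiniteBiproducts

variable {A B : Type u} [Ring A] [Ring B] [IsNoetherianRing B]
  {ι : A →+* B} {π : B →+* A} (hπι : π.comp ι = RingHom.id A) (hι : IsFiniteAlong ι)

/-- The projection from a module onto its reduction modulo the kernel of `π`, which is a module
restricted along `π`. -/
noncomputable def reductionHom :
    𝟭 (FGModuleCat.{u} B) ⟶ (fgQuotient (RingHom.ker π) ⋙ fgRestrict ι hι) ⋙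
      fgRestrict π (isFiniteAlong_of_section hπι) where
  app X := ObjectProperty.homMk (ModuleCat.ofHom
    (Y := (ModuleCat.restrictScalars.{u} π).obj ((ModuleCat.restrictScalars.{u} ι).obj
      (ModuleCat.of B (X ⧸ RingHom.ker π • (⊤ : Submodule B X)))))
    { toFun := fun x => Submodule.Quotient.mk x
      map_add' := fun _ _ => rfl
      -- The action on the target is through `ι (π b)`, and `b - ι (π b)` lies in the kernel of `π`.
      map_smul' := fun b x => by
        refine (Submodule.Quotient.eq _).2 ?_
        rw [← sub_smul]
        refine Submodule.smul_mem_smul ?_ trivial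
        rw [RingHom.mem_ker, map_sub, sub_eq_zero]
        exact (congr($hπι (π b))).symm })
  naturality X Y f := rfl

instance (X : FGModuleCat.{u} B) : Epi ((reductionHom hπι hι).app X) :=
  epi_of_surjective_fgModuleCat _ (Submodule.Quotient.mk_surjective _)

/-- With `I = ker π`, the kernel of `X ⟶ X / I X` embeds in `I X`, so it is killed by `I ^ k` once
`I ^ (k + 1)` kills `X`. -/
theorem hasNilpotentLength_reductionHom (k : ℕ) (X : FGModuleCat.{u} B)
    (hX : (RingHom.ker π ^ k) • (⊤ : Submodule B X) = ⊥) :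
    HasNilpotentLength (reductionHom hπι hι) k X := by
  induction k generalizing X with
  | zero =>
    rw [Submodule.pow_zero, Ideal.one_eq_top, Submodule.top_smul] at hX
    refine (IsZero.iff_id_eq_zero _).2 ?_
    ext x
    exact (Submodule.mem_bot B).1 (hX ▸ Submodule.mem_top (x := x))
  | succ k ih =>
    let j := kernel.ι ((reductionHom hπι hι).app X)
    have hj : Function.Injective j.hom.hom :=
      (ModuleCat.mono_iff_injective _).1
        (inferInstance : Mono ((forget₂ (FGModuleCat.{u} B) (ModuleCat.{u} B)).map j))
    have hj' : ∀ y, j.hom.hom y ∈ RingHom.ker π • (⊤ : Submodule B X) := fun y =>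
      (Submodule.Quotient.mk_eq_zero _).1
        congr($(kernel.condition ((reductionHom hπι hι).app X)).hom.hom y)
    refine ih _ (Submodule.map_injective_of_injective hj ?_)
    rw [Submodule.map_bot, Submodule.map_smul'', eq_bot_iff, ← hX, Submodule.pow_succ,
      Submodule.mul_smul]
    refine Submodule.smul_mono le_rfl ?_
    rintro _ ⟨y, -, rfl⟩
    exact hj' y

theorem hasNilpotentLength_of_pow_eq_bot {n : ℕ} (hn : RingHom.ker π ^ n = ⊥)
    (X : FGModuleCat.{u} B) : HasNilpotentLength (reductionHom hπι hι) n X :=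
  hasNilpotentLength_reductionHom hπι hι n X (by rw [hn, Submodule.bot_smul])

variable [IsNoetherianRing A]

/-- If the kernel of `π` is projective, projective modules restricted along `π` have projective
dimension at most one. -/
theorem exists_projective_resolution_fgRestrict (hker : Module.Projective B (RingHom.ker π))
    (hπ : IsFiniteAlong π) (hsurj : Function.Surjective π) (Q : FGModuleCat.{u} A)
    (hQ : Projective Q) :
    ∃ Q' P : FGModuleCat.{u} B, Projective Q' ∧ Projective P ∧
      ShortExactSeq Q' P ((fgRestrict π hπ).obj Q) := by
  have : Projective (FGModuleCat.of.{u} B B) := projective_fgModuleCat _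
  refine addClosure_le (Q := fun Q => ∃ Q' P : FGModuleCat.{u} B, Projective Q' ∧ Projective P ∧
    ShortExactSeq Q' P ((fgRestrict π hπ).obj Q)) ?_ ?_ ?_ ?_
    (addClosure_of_projective_fgModuleCat Q hQ)
  · intro X hX
    have hX' := (fgRestrict π hπ).map_isZero hX
    have : Projective ((fgRestrict π hπ).obj X) := Projective.of_iso hX'.isoZero.symm inferInstance
    exact ⟨_, _, this, this, .of_isZero_left hX' (Iso.refl _)⟩
  · rintro X Y ⟨Q₁, P₁, _, _, h₁⟩ ⟨Q₂, P₂, _, _, h₂⟩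
    have := preservesBinaryBiproducts_of_preservesBiproducts (fgRestrict π hπ)
    exact ⟨Q₁ ⊞ Q₂, P₁ ⊞ P₂, inferInstance, inferInstance, (h₁.biprod h₂).of_iso (Iso.refl _)
      (Iso.refl _) ((fgRestrict π hπ).mapBiprod _ _).symm⟩
  · rintro X Y r ⟨Q₁, P₁, _, _, h₁⟩
    obtain ⟨Q₂, P₂, hP₂, h₂⟩ := exists_shortExactSeq_fgModuleCat ((fgRestrict π hπ).obj X)
    have := projective_of_addClosure_eq hP₂
    -- Any first syzygy of a summand is a retract of the projective `Q₁ ⊞ P₂`, hence projective.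
    obtain ⟨s⟩ := h₂.retract_syzygy h₁ (r.map (fgRestrict π hπ))
    exact ⟨Q₂, P₂, s.projective, this, h₂⟩
  · rintro _ rfl
    -- For the regular module the resolution is `0 ⟶ ker π ⟶ B ⟶ A ⟶ 0`.
    have hQ' : Projective (FGModuleCat.of.{u} B (RingHom.ker π)) := projective_fgModuleCat _
    let i : FGModuleCat.of.{u} B (RingHom.ker π) ⟶ FGModuleCat.of.{u} B B :=
      FGModuleCat.ofHom (Submodule.subtype _)
    let p : FGModuleCat.of.{u} B B ⟶ (fgRestrict π hπ).obj (FGModuleCat.of.{u} A A) :=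
      ObjectProperty.homMk (ModuleCat.ofHom
        (Y := (ModuleCat.restrictScalars.{u} π).obj (ModuleCat.of A A))
        { toFun := fun b => π b
          map_add' := fun _ _ => map_add π _ _
          map_smul' := fun _ _ => map_mul π _ _ })
    have hi : Mono i := ConcreteCategory.mono_of_injective _ Subtype.val_injective
    have hp : Epi p := epi_of_surjective_fgModuleCat p hsurj
    refine ⟨_, _, hQ', this, i, p, ?_, shortExact_of_lift _ _ _ ?_⟩
    · ext x
      exact x.2
    · intro W g hg
      refine ⟨FGModuleCat.ofHom (LinearMap.codRestrict _ g.hom.hom fun w => ?_), rfl⟩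
      exact congr($(hg).hom.hom w)

/-- The dimensions of a split extension of rings with nilpotent kernel. -/
theorem dimensions_of_split_extension (hπι : π.comp ι = RingHom.id A) (hι : IsFiniteAlong ι)
    {n : ℕ} (hn : 1 ≤ n) (hker : RingHom.ker π ^ n = ⊥) :
    (Module.Projective A ((ModuleCat.restrictScalars.{u} ι).obj (ModuleCat.of B B)) →
      Module.Projective B (RingHom.ker π) →
        igusaTodorovDistance (FGModuleCat.{u} A) ≤ igusaTodorovDistance (FGModuleCat.{u} B) ∧
        igusaTodorovDistance (FGModuleCat.{u} B) ≤
          n * (igusaTodorovDistance (FGModuleCat.{u} A) + 1) - 1) ∧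
    (extensionDimension (FGModuleCat.{u} A) ≤ extensionDimension (FGModuleCat.{u} B) ∧
      extensionDimension (FGModuleCat.{u} B) ≤
        n * (extensionDimension (FGModuleCat.{u} A) + 1) - 1) ∧
    (letI := HasDerivedCategory.standard (FGModuleCat.{u} A);
      letI := HasDerivedCategory.standard (FGModuleCat.{u} B);
      rouquierDimension (DerivedCategory.Bounded (FGModuleCat.{u} A)) ≤
        rouquierDimension (DerivedCategory.Bounded (FGModuleCat.{u} B)) ∧
      rouquierDimension (DerivedCategory.Bounded (FGModuleCat.{u} B)) ≤
        n * (rouquierDimension (DerivedCategory.Bounded (FGModuleCat.{u} A)) + 1) - 1) := by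
  have hπ : IsFiniteAlong π := isFiniteAlong_of_section hπι
  let e := fgRestrictCompIso ι π hπι hι hπ
  have : (fgRestrict ι hι).EssSurj := ⟨fun X => ⟨_, ⟨e.app X⟩⟩⟩
  have hnil := hasNilpotentLength_of_pow_eq_bot hπι hι hker
  refine ⟨fun h₁ h₂ => ?_, ⟨extensionDimension_le_of_essSurj (fgRestrict ι hι),
    extensionDimension_le_mul (reductionHom hπι hι) hn hnil⟩, ?_⟩
  · have := preservesProjectiveObjects_fgRestrict ι hι h₁
    have : Projective (FGModuleCat.of.{u} B B) := projective_fgModuleCat _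
    exact ⟨igusaTodorovDistance_le_of_essSurj (fgRestrict ι hι),
      igusaTodorovDistance_le_mul (reductionHom hπι hι) exists_shortExactSeq_fgModuleCat
        (exists_projective_resolution_fgRestrict h₂ hπ fun a => ⟨ι a, congr($hπι a)⟩) hn hnil⟩
  · let := HasDerivedCategory.standard (FGModuleCat.{u} A)
    let := HasDerivedCategory.standard (FGModuleCat.{u} B)
    exact ⟨rouquierDimension_bounded_le_of_section (fgRestrict ι hι) _ e,
      rouquierDimension_bounded_le_mul (reductionHom hπι hι) hn hnil⟩

end SplitExtension

/-! ### Balanced maps and tensor powers of a bimodule. -/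

section BalancedTensorLift

variable {A : Type u} [Ring A] {X Y Z : Type u} [AddCommGroup X] [AddCommGroup Y]
  [AddCommGroup Z] [Module Aᵐᵒᵖ X] [Module A Y]

/-- The homomorphism from `X ⊗_A Y` induced by a balanced biadditive map. -/
noncomputable def BalancedTensor.lift (f : X →+ Y →+ Z)
    (hf : ∀ (x : X) (a : A) (y : Y), f (MulOpposite.op a • x) y = f x (a • y)) :
    BalancedTensor A X Y →+ Z :=
  QuotientAddGroup.lift (balancedRelations A X Y)
    (TensorProduct.liftAddHom f fun r x y => by simp) (by
      refine (AddSubgroup.closure_le _).2 ?_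
      rintro _ ⟨x, a, y, rfl⟩
      simp [hf])

end BalancedTensorLift

namespace BimodulePower

variable {A M : Type u} [Ring A] [AddCommGroup M] [Module A M] [Module Aᵐᵒᵖ M]
  [SMulCommClass A Aᵐᵒᵖ M]

/-- The product of an element of a tensor power with an element of the bimodule. -/
noncomputable def tmul (i : ℕ) : BimodulePower A M i →+ M →+ BimodulePower A M (i + 1) :=
  AddMonoidHom.mk' (fun x => AddMonoidHom.mk' (fun m => BalancedTensor.tmul A x m)
    (BalancedTensor.tmul_add x)) fun x y => by
      ext m
      exact BalancedTensor.add_tmul x y m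

theorem op_smul_tmul (i : ℕ) (a : Aᵐᵒᵖ) (x : BimodulePower A M i) (m : M) :
    a • tmul i x m = tmul i x (a • m) := rfl

theorem tmul_smul (i : ℕ) (a : A) (x : BimodulePower A M i) (m : M) :
    tmul i (MulOpposite.op a • x) m = tmul i x (a • m) := by
  refine (QuotientAddGroup.eq_iff_sub_mem (N := balancedRelations A _ M)).2 ?_
  exact AddSubgroup.subset_closure ⟨x, a, m, rfl⟩

theorem induction_on {i : ℕ} {p : BimodulePower A M (i + 1) → Prop}
    (t : BimodulePower A M (i + 1)) (zero : p 0) (tmul : ∀ x m, p (tmul i x m))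
    (add : ∀ s t, p s → p t → p (s + t)) : p t :=
  BalancedTensor.induction_on (A := A) t zero tmul add

theorem hom_ext {i : ℕ} {Z : Type*} [AddCommGroup Z] {f g : BimodulePower A M (i + 1) →+ Z}
    (h : ∀ x m, f (tmul i x m) = g (tmul i x m)) : f = g := by
  ext t
  induction t using induction_on with
  | zero => simp
  | tmul x m => exact h x m
  | add s t hs ht => simp [hs, ht]

theorem subsingleton_of_le {n i : ℕ} (hn : Subsingleton (BimodulePower A M n)) (hi : n ≤ i) :
    Subsingleton (BimodulePower A M i) := by
  induction i, hi using Nat.le_induction with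
  | base => exact hn
  | succ i _ ih =>
    refine subsingleton_of_forall_eq 0 fun t => ?_
    induction t using induction_on with
    | zero => rfl
    | tmul x m => rw [Subsingleton.elim x 0, map_zero, AddMonoidHom.zero_apply]
    | add s t hs ht => rw [hs, ht, add_zero]

/-- The homomorphism from a tensor power induced by a balanced biadditive map. -/
noncomputable def lift {i : ℕ} {Z : Type u} [AddCommGroup Z] (f : BimodulePower A M i →+ M →+ Z)
    (hf : ∀ (x : BimodulePower A M i) (a : A) (m : M),
      f (MulOpposite.op a • x) m = f x (a • m)) : BimodulePower A M (i + 1) →+ Z :=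
  BalancedTensor.lift f hf

/-- The homomorphism of right modules from a tensor power induced by a balanced map which is
linear in the second variable. -/
noncomputable def liftLinear {i : ℕ} {Z : Type u} [AddCommGroup Z] [Module Aᵐᵒᵖ Z]
    (f : BimodulePower A M i →+ M →ₗ[Aᵐᵒᵖ] Z)
    (hf : ∀ (x : BimodulePower A M i) (a : A) (m : M),
      f (MulOpposite.op a • x) m = f x (a • m)) : BimodulePower A M (i + 1) →ₗ[Aᵐᵒᵖ] Z :=
  { lift (AddMonoidHom.mk' (fun x => (f x).toAddMonoidHom) fun x y => by ext; simp) hf with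
    map_smul' := fun a t => by
      induction t using induction_on with
      | zero => simp
      | tmul x m => exact (f x).map_smul a m
      | add s t hs ht =>
        rw [smul_add]
        simp_all }

@[simp] theorem liftLinear_tmul {i : ℕ} {Z : Type u} [AddCommGroup Z] [Module Aᵐᵒᵖ Z]
    (f : BimodulePower A M i →+ M →ₗ[Aᵐᵒᵖ] Z)
    (hf : ∀ (x : BimodulePower A M i) (a : A) (m : M),
      f (MulOpposite.op a • x) m = f x (a • m)) (x : BimodulePower A M i) (m : M) :
    liftLinear f hf (tmul i x m) = f x m := rfl

/-- Multiplication by a fixed element of a tensor power, as a map of right modules. -/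
noncomputable def tmulLinear (i : ℕ) (x : BimodulePower A M i) :
    M →ₗ[Aᵐᵒᵖ] BimodulePower A M (i + 1) :=
  { tmul i x with map_smul' := fun _ _ => rfl }

variable (A M) in
/-- The zeroth tensor power is the regular right module. -/
def zeroEquiv : Aᵐᵒᵖ ≃ₗ[Aᵐᵒᵖ] BimodulePower A M 0 where
  toFun a := a.unop
  invFun a := MulOpposite.op a
  map_add' _ _ := rfl
  map_smul' _ _ := rfl
  left_inv _ := rfl
  right_inv _ := rfl

/-- If a finite set `s` generates the `i`-th power on the right, the maps `m ↦ x ⊗ m` for `x ∈ s`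
jointly cover the next power, since scalars slide across the tensor sign into `M`. -/
theorem finite [Module.Finite Aᵐᵒᵖ M] (i : ℕ) : Module.Finite Aᵐᵒᵖ (BimodulePower A M i) := by
  induction i with
  | zero => exact Module.Finite.equiv (zeroEquiv A M)
  | succ i ih =>
    classical
    obtain ⟨s, hs⟩ := ih.fg_top
    refine Module.Finite.of_surjective
      (∑ x : s, (tmulLinear i x.1).comp (LinearMap.proj (R := Aᵐᵒᵖ) (φ := fun _ : s => M) x)) ?_
    rw [← LinearMap.range_eq_top, eq_top_iff]
    rintro t -
    induction t using induction_on with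
    | zero => exact Submodule.zero_mem _
    | add s t hs ht => exact Submodule.add_mem _ hs ht
    | tmul x m =>
      have hx : x ∈ Submodule.span Aᵐᵒᵖ (s : Set (BimodulePower A M i)) := hs ▸ trivial
      induction hx using Submodule.span_induction generalizing m with
      | mem x hx =>
        refine ⟨Pi.single ⟨x, hx⟩ m, ?_⟩
        rw [LinearMap.sum_apply, Finset.sum_eq_single ⟨x, hx⟩]
        · simp [tmulLinear]
        · intro y _ hy
          simp [Pi.single_eq_of_ne hy]
        · simp
      | zero => simp
      | add x y _ _ hx hy =>
        rw [map_add]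
        exact Submodule.add_mem _ (hx m) (hy m)
      | smul a x _ hx =>
        rw [← MulOpposite.op_unop a, tmul_smul]
        exact hx _

end BimodulePower

/-! ### Dual bases, projectivity of tensor powers and contractions. -/

section DualBasis

variable {A X : Type u} [Ring A] [AddCommGroup X] [Module Aᵐᵒᵖ X]

/-- Finitely generated projective right modules have dual bases. -/
theorem exists_dual_basis [Module.Finite Aᵐᵒᵖ X] [Module.Projective Aᵐᵒᵖ X] :
    ∃ (k : ℕ) (x : Fin k → X) (f : Fin k → X →ₗ[Aᵐᵒᵖ] A),
      ∀ y, ∑ i, MulOpposite.op (f i y) • x i = y := by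
  obtain ⟨k, p, s, -, -, h⟩ := Module.Finite.exists_comp_eq_id_of_projective Aᵐᵒᵖ X
  -- Coordinates are read in `A` rather than `Aᵐᵒᵖ`, so that they can act from the left on a
  -- bimodule.
  let e : Aᵐᵒᵖ →ₗ[Aᵐᵒᵖ] A :=
    { toFun := MulOpposite.unop, map_add' := fun _ _ => rfl, map_smul' := fun _ _ => rfl }
  refine ⟨k, fun i => p (Pi.single i 1), fun i => e.comp ((LinearMap.proj i).comp s),
    fun y => ?_⟩
  conv_rhs => rw [← LinearMap.id_apply (R := Aᵐᵒᵖ) y, ← h, LinearMap.comp_apply,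
    pi_eq_sum_univ (s y), map_sum]
  refine Finset.sum_congr rfl fun i _ => ?_
  rw [← map_smul]
  congr 1
  ext j
  simp [e, Pi.single_apply, eq_comm]

variable {M : Type u} [AddCommGroup M] [Module A M] [Module Aᵐᵒᵖ M] [SMulCommClass A Aᵐᵒᵖ M]

namespace BimodulePower

/-- A dual basis of the `i`-th power, tensored with `M`, exhibits the next power as a direct summand
of `Mᵏ`. -/
theorem projective [Module.Finite Aᵐᵒᵖ M] [Module.Projective Aᵐᵒᵖ M] (i : ℕ) :
    Module.Projective Aᵐᵒᵖ (BimodulePower A M i) := by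
  induction i with
  | zero => exact Module.Projective.of_equiv (zeroEquiv A M)
  | succ i ih =>
    have := finite (A := A) (M := M) i
    have : SMulCommClass Aᵐᵒᵖ A M := SMulCommClass.symm _ _ _
    obtain ⟨k, x, f, h⟩ := exists_dual_basis (A := A) (X := BimodulePower A M i)
    let s : BimodulePower A M (i + 1) →ₗ[Aᵐᵒᵖ] (Fin k → M) := liftLinear
      (AddMonoidHom.mk' (fun y => LinearMap.pi fun j => DistribSMul.toLinearMap Aᵐᵒᵖ M (f j y))
        fun y z => by
          ext m j
          simp [add_smul])
      fun y a m => by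
        ext j
        simp [mul_smul]
    let p : (Fin k → M) →ₗ[Aᵐᵒᵖ] BimodulePower A M (i + 1) :=
      ∑ j, (tmulLinear i (x j)).comp (LinearMap.proj j)
    have : Module.Projective Aᵐᵒᵖ (Fin k → M) :=
      .of_equiv (DirectSum.linearEquivFunOnFintype Aᵐᵒᵖ (Fin k) fun _ => M)
    refine Module.Projective.of_split s p (LinearMap.toAddMonoidHom_injective (hom_ext ?_))
    intro y m
    have : p (s (tmul i y m)) = ∑ j, tmul i (x j) (f j y • m) := by
      simp [p, s, tmulLinear]
    refine this.trans ?_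
    simp_rw [← tmul_smul]
    rw [← AddMonoidHom.finsetSum_apply, ← map_sum, h]
    rfl

/-- Contraction of the first factor of a tensor power with a linear form. -/
noncomputable def contract (f : M →ₗ[Aᵐᵒᵖ] A) :
    ∀ i, BimodulePower A M (i + 1) →ₗ[Aᵐᵒᵖ] BimodulePower A M i
  -- The first power is `A ⊗ M` and not `M` itself, so contraction starts as `a ⊗ m ↦ f (a m)`;
  -- higher powers grow on the right, leaving the contracted factor alone.
  | 0 => haveI : SMulCommClass Aᵐᵒᵖ A M := SMulCommClass.symm _ _ _
    liftLinear (Z := A) (AddMonoidHom.mk' (fun a : A => f.comp (DistribSMul.toLinearMap Aᵐᵒᵖ M a))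
      fun a b => by
        ext m
        simp [add_smul]) fun (b : A) a m => by
          change f ((b * a) • m) = f (b • a • m)
          rw [mul_smul]
  | i + 1 => liftLinear (AddMonoidHom.mk' (fun x => tmulLinear i (contract f i x)) fun x y => by
      ext m
      simp [tmulLinear]) fun x a m => by
        simp [tmulLinear, tmul_smul]

end BimodulePower

end DualBasis

/-! ### The universal property of the tensor ring. -/

namespace TensorRing

section UniversalProperty

variable (A M : Type u) [Ring A] [AddCommGroup M] [Module A M] [Module Aᵐᵒᵖ M]

/-- The inclusion of the base ring. -/
noncomputable def ofRing : A →+* TensorRing A M :=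
  letI q := RingQuot.mkRingHom (TensorRingRel A M)
  { toFun := fun a => q (FreeAlgebra.ι ℤ (Sum.inl a))
    map_one' := (RingQuot.mkRingHom_rel .one).trans (map_one q)
    map_mul' := fun a b => (RingQuot.mkRingHom_rel (.mul a b)).trans (map_mul q _ _)
    map_zero' := by
      have h := (RingQuot.mkRingHom_rel (.add (M := M) (0 : A) 0)).trans (map_add q _ _)
      rw [add_zero] at h
      exact left_eq_add.1 h
    map_add' := fun a b => (RingQuot.mkRingHom_rel (.add a b)).trans (map_add q _ _) }

/-- The inclusion of the bimodule. -/
noncomputable def ofBimodule : M →+ TensorRing A M :=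
  letI q := RingQuot.mkRingHom (TensorRingRel A M)
  AddMonoidHom.mk' (fun m => q (FreeAlgebra.ι ℤ (Sum.inr m))) fun x y =>
    (RingQuot.mkRingHom_rel (.add_right x y)).trans (map_add q _ _)

variable {A M}

theorem ofBimodule_smul (a : A) (m : M) :
    ofBimodule A M (a • m) = ofRing A M a * ofBimodule A M m :=
  (RingQuot.mkRingHom_rel (.left_smul a m)).trans (map_mul _ _ _)

theorem ofBimodule_op_smul (a : A) (m : M) :
    ofBimodule A M (MulOpposite.op a • m) = ofBimodule A M m * ofRing A M a :=
  (RingQuot.mkRingHom_rel (.right_smul a m)).trans (map_mul _ _ _)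

theorem induction_on {p : TensorRing A M → Prop} (t : TensorRing A M)
    (ofRing : ∀ a, p (ofRing A M a)) (ofBimodule : ∀ m, p (ofBimodule A M m))
    (add : ∀ s t, p s → p t → p (s + t)) (mul : ∀ s t, p s → p t → p (s * t)) : p t := by
  obtain ⟨t, rfl⟩ := RingQuot.mkRingHom_surjective (TensorRingRel A M) t
  induction t with
  | grade0 r =>
    have h : RingQuot.mkRingHom (TensorRingRel A M) (algebraMap ℤ _ r) =
        TensorRing.ofRing A M (r : A) :=
      (congrArg _ (eq_intCast _ r)).trans ((map_intCast _ r).trans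
        (map_intCast (TensorRing.ofRing A M) r).symm)
    exact h ▸ ofRing _
  | grade1 x => exact x.rec ofRing ofBimodule
  | mul s t hs ht => exact (map_mul (RingQuot.mkRingHom (TensorRingRel A M)) s t) ▸ mul _ _ hs ht
  | add s t hs ht => exact (map_add (RingQuot.mkRingHom (TensorRingRel A M)) s t) ▸ add _ _ hs ht

variable {S : Type*} [Ring S] (f : A →+* S) (g : M →+ S)
  (hl : ∀ a m, g (a • m) = f a * g m)
  (hr : ∀ (a : A) m, g (MulOpposite.op a • m) = g m * f a)

/-- The universal property of the tensor ring. -/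
noncomputable def lift : TensorRing A M →+* S :=
  RingQuot.lift ⟨(FreeAlgebra.lift ℤ (Sum.elim f g)).toRingHom, by
    rintro _ _ (_ | _ | _ | _ | _ | _) <;> simp [hl, hr]⟩

@[simp] theorem lift_ofRing (a : A) : lift f g hl hr (ofRing A M a) = f a :=
  (RingQuot.lift_mkRingHom_apply _ _ _).trans (by simp)

@[simp] theorem lift_ofBimodule (m : M) : lift f g hl hr (ofBimodule A M m) = g m :=
  (RingQuot.lift_mkRingHom_apply _ _ _).trans (by simp)

variable (A M) in
/-- The projection onto the base ring. -/
noncomputable def toRing : TensorRing A M →+* A :=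
  lift (RingHom.id A) 0 (by simp) (by simp)

@[simp] theorem toRing_ofRing (a : A) : toRing A M (ofRing A M a) = a := lift_ofRing _ _ _ _ _

@[simp] theorem toRing_ofBimodule (m : M) : toRing A M (ofBimodule A M m) = 0 :=
  lift_ofBimodule _ _ _ _ _

end UniversalProperty

/-! ### The tensor ring as the direct sum of the tensor powers. -/

section Grading

open DirectSum

variable (A M : Type u) [Ring A] [AddCommGroup M] [Module A M] [Module Aᵐᵒᵖ M]
  [SMulCommClass A Aᵐᵒᵖ M]

variable {A M} in
/-- The extension to the next tensor power of a homomorphism of right modules to the tensor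
ring. -/
noncomputable def ofPowerSucc {i : ℕ} (f : BimodulePower A M i →+ TensorRing A M)
    (hf : ∀ (a : A) x, f (MulOpposite.op a • x) = f x * ofRing A M a) :
    BimodulePower A M (i + 1) →+ TensorRing A M :=
  BimodulePower.lift (AddMonoidHom.mk' (fun x => (AddMonoidHom.mulLeft (f x)).comp
    (ofBimodule A M)) fun x y => by
      ext m
      simp [add_mul]) fun x a m => by
        simp [hf, ofBimodule_smul, mul_assoc]

variable {A M} in
theorem ofPowerSucc_tmul {i : ℕ} (f : BimodulePower A M i →+ TensorRing A M)
    (hf : ∀ (a : A) x, f (MulOpposite.op a • x) = f x * ofRing A M a)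
    (x : BimodulePower A M i) (m : M) :
    ofPowerSucc f hf (BimodulePower.tmul i x m) = f x * ofBimodule A M m := rfl

variable {A M} in
theorem ofPowerSucc_op_smul {i : ℕ} (f : BimodulePower A M i →+ TensorRing A M)
    (hf : ∀ (a : A) x, f (MulOpposite.op a • x) = f x * ofRing A M a)
    (a : A) (x : BimodulePower A M (i + 1)) :
    ofPowerSucc f hf (MulOpposite.op a • x) = ofPowerSucc f hf x * ofRing A M a := by
  induction x using BimodulePower.induction_on with
  | zero => simp
  | tmul x m =>
    rw [BimodulePower.op_smul_tmul, ofPowerSucc_tmul, ofPowerSucc_tmul, ofBimodule_op_smul,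
      mul_assoc]
  | add s t hs ht => rw [smul_add, map_add, map_add, hs, ht, add_mul]

/-- The map from a tensor power to the tensor ring, together with its compatibility with the
right action. -/
noncomputable def ofPowerAux (i : ℕ) : { f : BimodulePower A M i →+ TensorRing A M //
    ∀ (a : A) x, f (MulOpposite.op a • x) = f x * ofRing A M a } :=
  Nat.rec ⟨(ofRing A M).toAddMonoidHom, fun a (x : A) => map_mul (ofRing A M) x a⟩
    (fun _ f => ⟨ofPowerSucc f.1 f.2, ofPowerSucc_op_smul f.1 f.2⟩) i

/-- The map from a tensor power to the tensor ring. -/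
noncomputable def ofPower (i : ℕ) : BimodulePower A M i →+ TensorRing A M := (ofPowerAux A M i).1

variable {A M}

theorem ofPower_op_smul (i : ℕ) (a : Aᵐᵒᵖ) (x : BimodulePower A M i) :
    ofPower A M i (a • x) = ofPower A M i x * ofRing A M a.unop := (ofPowerAux A M i).2 a.unop x

@[simp] theorem ofPower_tmul (i : ℕ) (x : BimodulePower A M i) (m : M) :
    ofPower A M (i + 1) (BimodulePower.tmul i x m) = ofPower A M i x * ofBimodule A M m := rfl

variable (A M) in
/-- The direct sum of the tensor powers. -/
abbrev Graded : Type u := ⨁ i, BimodulePower A M i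

theorem op_smul_of (a : Aᵐᵒᵖ) (i : ℕ) (x : BimodulePower A M i) :
    a • of (BimodulePower A M) i x = of _ i (a • x) := (DirectSum.of_smul Aᵐᵒᵖ i a x).symm

variable (A M) in
/-- The map from the direct sum of the tensor powers to the tensor ring. -/
noncomputable def ofGraded : Graded A M →+ TensorRing A M := DirectSum.toAddMonoid (ofPower A M)

@[simp] theorem ofGraded_of (i : ℕ) (x : BimodulePower A M i) :
    ofGraded A M (of _ i x) = ofPower A M i x := DirectSum.toAddMonoid_of _ _ _

theorem ofGraded_op_smul (a : Aᵐᵒᵖ) (s : Graded A M) :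
    ofGraded A M (a • s) = ofGraded A M s * ofRing A M a.unop := by
  induction s using DirectSum.induction_on with
  | zero => simp
  | of i x =>
    simp [op_smul_of, ofPower_op_smul]
  | add s t hs ht => rw [smul_add, map_add, map_add, hs, ht, add_mul]

variable (A) in
/-- Right multiplication by an element of the bimodule. -/
noncomputable def shiftRight (m : M) : Graded A M →+ Graded A M :=
  DirectSum.toAddMonoid fun i => (of _ (i + 1)).comp ((BimodulePower.tmul i).flip m)

@[simp] theorem shiftRight_of (m : M) (i : ℕ) (x : BimodulePower A M i) :
    shiftRight A m (of _ i x) = of _ (i + 1) (BimodulePower.tmul i x m) :=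
  DirectSum.toAddMonoid_of _ _ _

variable (A M) in
/-- The right action of the tensor ring on the direct sum of the tensor powers. -/
noncomputable def action : TensorRing A M →+* (AddMonoid.End (Graded A M))ᵐᵒᵖ :=
  lift ((Module.toAddMonoidEnd Aᵐᵒᵖ (Graded A M)).op.comp (RingEquiv.opOp A).toRingHom)
    (AddMonoidHom.mk' (fun m => MulOpposite.op (shiftRight A m)) fun m m' => by
      refine congrArg MulOpposite.op (DirectSum.addHom_ext fun i x => ?_)
      change shiftRight A (m + m') (of _ i x) =
        shiftRight A m (of _ i x) + shiftRight A m' (of _ i x)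
      simp)
    (fun a m => by
      refine congrArg MulOpposite.op (DirectSum.addHom_ext fun i x => ?_)
      change shiftRight A _ _ =
        shiftRight A _ (MulOpposite.op a • of (BimodulePower A M) i x)
      simp [op_smul_of, BimodulePower.tmul_smul])
    (fun a m => by
      refine congrArg MulOpposite.op (DirectSum.addHom_ext fun i x => ?_)
      change shiftRight A _ _ = MulOpposite.op a • shiftRight A m (of _ i x)
      simp [op_smul_of, BimodulePower.op_smul_tmul])

/-- The product of an element of the graded object with an element of the tensor ring. -/
noncomputable def act (t : TensorRing A M) : Graded A M →+ Graded A M := (action A M t).unop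

@[simp] theorem act_ofRing (a : A) (s : Graded A M) :
    act (ofRing A M a) s = MulOpposite.op a • s :=
  DFunLike.congr_fun (congrArg (MulOpposite.unop (α := AddMonoid.End (Graded A M))) (lift_ofRing _ _ _ _ a)) s

@[simp] theorem act_ofBimodule (m : M) (s : Graded A M) :
    act (ofBimodule A M m) s = shiftRight A m s :=
  DFunLike.congr_fun (congrArg
    (MulOpposite.unop (α := AddMonoid.End (Graded A M))) (lift_ofBimodule _ _ _ _ m)) s

theorem act_mul (t t' : TensorRing A M) (s : Graded A M) :
    act (t * t') s = act t' (act t s) :=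
  congr($(map_mul (action A M) t t').unop s)

theorem act_zero (s : Graded A M) : act 0 s = 0 :=
  congr($(map_zero (action A M)).unop s)

theorem act_add (t t' : TensorRing A M) (s : Graded A M) :
    act (t + t') s = act t s + act t' s :=
  congr($(map_add (action A M) t t').unop s)

/-- No multiplication is put on the direct sum: it is enough that it is a right module over the
tensor ring and `ofGraded` is linear. Evaluating the action at the unit then inverts `ofGraded`. -/
theorem ofGraded_act (t : TensorRing A M) (s : Graded A M) :
    ofGraded A M (act t s) = ofGraded A M s * t := by
  induction t using induction_on generalizing s with
  | ofRing a => simp [ofGraded_op_smul]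
  | ofBimodule m =>
    rw [act_ofBimodule]
    induction s using DirectSum.induction_on with
    | zero => simp
    | of i x => simp
    | add s t hs ht => rw [map_add, map_add, map_add, hs, ht, add_mul]
  | add t t' h h' => rw [act_add, map_add, h, h', mul_add]
  | mul t t' h h' => rw [act_mul, h', h, mul_assoc]

variable (A M) in
/-- The unit of the direct sum of the tensor powers. -/
noncomputable def gradedOne : Graded A M := of (BimodulePower A M) 0 (1 : A)

theorem act_ofPower_one (i : ℕ) (x : BimodulePower A M i) :
    act (ofPower A M i x) (gradedOne A M) = of _ i x := by
  induction i with
  | zero =>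
    refine (act_ofRing _ _).trans ((op_smul_of _ _ _).trans ?_)
    exact congrArg _ (one_mul (M := A) x)
  | succ i ih =>
    induction x using BimodulePower.induction_on with
    | zero =>
      rw [map_zero, map_zero, act_zero]
    | tmul x m => rw [ofPower_tmul, act_mul, ih, act_ofBimodule, shiftRight_of]
    | add s t hs ht => rw [map_add, act_add, hs, ht, map_add]

theorem act_ofGraded_one (s : Graded A M) : act (ofGraded A M s) (gradedOne A M) = s := by
  induction s using DirectSum.induction_on with
  | zero => rw [map_zero, act_zero]
  | of i x => rw [ofGraded_of, act_ofPower_one]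
  | add s t hs ht => rw [map_add, act_add, hs, ht]

theorem ofGraded_gradedOne : ofGraded A M (gradedOne A M) = 1 :=
  (ofGraded_of _ _).trans (map_one (ofRing A M))

variable (A M) in
/-- The tensor ring is the direct sum of the tensor powers. -/
noncomputable def gradedEquiv : Graded A M ≃+ TensorRing A M where
  toFun := ofGraded A M
  invFun t := act t (gradedOne A M)
  left_inv := act_ofGraded_one
  right_inv t := by rw [ofGraded_act, ofGraded_gradedOne, one_mul]
  map_add' := map_add _

/-- The augmentation is the degree-zero component, so its kernel consists of the elements of
positive degree. -/
theorem toRing_ofGraded (s : Graded A M) : toRing A M (ofGraded A M s) = s 0 := by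
  refine DFunLike.congr_fun (f := (toRing A M).toAddMonoidHom.comp (ofGraded A M))
    (g := (DFinsupp.evalAddMonoidHom 0 : Graded A M →+ BimodulePower A M 0))
    (DirectSum.addHom_ext fun i x => ?_) s
  change toRing A M (ofGraded A M (of _ i x)) = of (BimodulePower A M) i x 0
  rw [ofGraded_of]
  cases i with
  | zero => exact (toRing_ofRing _).trans (DirectSum.of_eq_same _ _).symm
  | succ i =>
    rw [DirectSum.of_eq_of_ne _ _ _ (by simp)]
    induction x using BimodulePower.induction_on with
    | zero => rw [map_zero, map_zero]; rfl
    | tmul x m => rw [ofPower_tmul, map_mul, toRing_ofBimodule, mul_zero]; rfl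
    | add s t hs ht => rw [map_add, map_add, hs, ht]; exact add_zero (0 : A)

end Grading

end TensorRing

namespace TensorRing

open DirectSum

variable {A M : Type u} [Ring A] [AddCommGroup M] [Module A M] [Module Aᵐᵒᵖ M]
  [SMulCommClass A Aᵐᵒᵖ M]

/-! ### Nilpotency of the augmentation ideal. -/

section Nilpotent

/-- The elements of the direct sum of the tensor powers with components in degrees at least
`k`. -/
def filtration (k : ℕ) : AddSubgroup (Graded A M) where
  carrier := {s | ∀ i < k, s i = 0}
  add_mem' hs ht i hi := by rw [DirectSum.add_apply, hs i hi, ht i hi, add_zero]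
  zero_mem' i _ := rfl
  neg_mem' hs i hi := (congrArg Neg.neg (hs i hi)).trans neg_zero

theorem of_mem_filtration {k i : ℕ} (h : k ≤ i) (x : BimodulePower A M i) :
    of (BimodulePower A M) i x ∈ filtration k := fun j hj =>
  DirectSum.of_eq_of_ne _ _ _ (by omega)

theorem filtration_induction {k : ℕ} {p : Graded A M → Prop} {s : Graded A M}
    (hs : s ∈ filtration k) (zero : p 0) (of : ∀ i, k ≤ i → ∀ x, p (of _ i x))
    (add : ∀ s t, p s → p t → p (s + t)) : p s := by
  classical
  rw [← DirectSum.sum_support_of s]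
  refine Finset.sum_induction _ p add zero fun i hi => of i ?_ _
  by_contra! h
  exact (DFinsupp.mem_support_iff.1 hi) (hs i h)

theorem shiftRight_mem_filtration {k : ℕ} {s : Graded A M} (hs : s ∈ filtration k) (m : M) :
    shiftRight A m s ∈ filtration (k + 1) :=
  filtration_induction (p := fun s => shiftRight A m s ∈ filtration (k + 1)) hs
    (by rw [map_zero]; exact AddSubgroup.zero_mem _)
    (fun i hi x => by rw [shiftRight_of]; exact of_mem_filtration (by omega) _)
    fun s t hs ht => by rw [map_add]; exact AddSubgroup.add_mem _ hs ht

theorem act_ofPower_mem_filtration {k : ℕ} {s : Graded A M} (hs : s ∈ filtration k) (i : ℕ)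
    (x : BimodulePower A M i) : act (ofPower A M i x) s ∈ filtration (k + i) := by
  induction i with
  | zero =>
    intro j hj
    refine (congrArg (fun s : Graded A M => s j) (act_ofRing (M := M) (show A from x) s)).trans ?_
    change MulOpposite.op (show A from x) • s j = 0
    rw [hs j hj, smul_zero]
  | succ i ih =>
    induction x using BimodulePower.induction_on with
    | zero =>
      rw [map_zero, act_zero]
      exact AddSubgroup.zero_mem _
    | tmul x m =>
      rw [ofPower_tmul, act_mul, act_ofBimodule]
      exact shiftRight_mem_filtration (ih x) m
    | add x y hx hy =>
      rw [map_add, act_add]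
      exact AddSubgroup.add_mem _ hx hy

theorem act_mem_filtration {k l : ℕ} {s t : Graded A M} (hs : s ∈ filtration k)
    (ht : t ∈ filtration l) : act (ofGraded A M t) s ∈ filtration (k + l) :=
  filtration_induction (p := fun t => act (ofGraded A M t) s ∈ filtration (k + l)) ht
    (by rw [map_zero, act_zero]; exact AddSubgroup.zero_mem _)
    (fun i hi x => by
      rw [ofGraded_of]
      exact fun j hj => act_ofPower_mem_filtration hs i x j (by omega))
    fun t t' h h' => by rw [map_add, act_add]; exact AddSubgroup.add_mem _ h h'

theorem gradedEquiv_symm_mem_filtration_one {t : TensorRing A M} (ht : toRing A M t = 0) :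
    (gradedEquiv A M).symm t ∈ filtration 1 := by
  intro i hi
  obtain rfl : i = 0 := by omega
  rw [← toRing_ofGraded]
  exact (congrArg _ ((gradedEquiv A M).apply_symm_apply t)).trans ht

theorem gradedEquiv_symm_mul (t t' : TensorRing A M) :
    (gradedEquiv A M).symm (t * t') =
      act (ofGraded A M ((gradedEquiv A M).symm t')) ((gradedEquiv A M).symm t) := by
  refine (act_mul t t' _).trans ?_
  exact congrArg (act · _) ((gradedEquiv A M).apply_symm_apply t').symm

theorem gradedEquiv_symm_mem_filtration {k : ℕ} {t : (TensorRing A M)ᵐᵒᵖ}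
    (ht : t ∈ RingHom.ker (toRing A M).op ^ k) :
    (gradedEquiv A M).symm t.unop ∈ filtration k := by
  induction k generalizing t with
  | zero => exact fun i hi => absurd hi (by omega)
  | succ k ih =>
    rw [Submodule.pow_succ] at ht
    induction ht using Submodule.mul_induction_on' with
    | mem_mul_mem s hs t ht =>
      -- Products are reversed in the opposite ring: the factor from the ideal is acted on by the
      -- one from its `k`-th power, so the degrees add as `1 + k`.
      rw [MulOpposite.unop_mul, gradedEquiv_symm_mul, add_comm]
      exact act_mem_filtration (gradedEquiv_symm_mem_filtration_one
        (congrArg MulOpposite.unop ht)) (ih hs)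
    | add s _ t _ hs ht =>
      rw [MulOpposite.unop_add, map_add]
      exact AddSubgroup.add_mem _ hs ht

theorem ker_toRing_pow {n : ℕ} (hn : Subsingleton (BimodulePower A M n)) :
    RingHom.ker (toRing A M).op ^ n = ⊥ := by
  refine eq_bot_iff.2 fun t ht => MulOpposite.unop_injective ?_
  refine (gradedEquiv A M).symm.injective ?_
  rw [MulOpposite.unop_zero, map_zero]
  refine DFinsupp.ext fun i => ?_
  by_cases hi : i < n
  · exact gradedEquiv_symm_mem_filtration ht i hi
  · exact (BimodulePower.subsingleton_of_le hn (not_lt.1 hi)).elim _ _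

end Nilpotent

/-! ### The tensor ring as a right module over the base ring. -/

section Finiteness

variable (A M) in
/-- The tensor ring as a right module over the base ring. -/
noncomputable abbrev opAsModule : ModuleCat.{u} Aᵐᵒᵖ :=
  (ModuleCat.restrictScalars.{u} (ofRing A M).op).obj
    (ModuleCat.of (TensorRing A M)ᵐᵒᵖ (TensorRing A M)ᵐᵒᵖ)

variable (A M) in
/-- The grading of the tensor ring as an isomorphism of right modules. -/
noncomputable def gradedLinearEquiv : Graded A M ≃ₗ[Aᵐᵒᵖ] opAsModule A M :=
  { (gradedEquiv A M).trans MulOpposite.opAddEquiv with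
    map_smul' := fun a s => congrArg MulOpposite.op (ofGraded_op_smul a s) }

theorem finite_graded [Module.Finite Aᵐᵒᵖ M] {n : ℕ}
    (hn : Subsingleton (BimodulePower A M n)) : Module.Finite Aᵐᵒᵖ (Graded A M) := by
  have := BimodulePower.finite (A := A) (M := M)
  refine Module.Finite.of_surjective (M := ∀ i : Fin n, BimodulePower A M i)
    (∑ i : Fin n, (DirectSum.lof Aᵐᵒᵖ ℕ (BimodulePower A M) i).comp (LinearMap.proj i)) ?_
  rw [← LinearMap.range_eq_top, eq_top_iff]
  rintro s -
  induction s using DirectSum.induction_on with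
  | zero => exact Submodule.zero_mem _
  | add s t hs ht => exact Submodule.add_mem _ hs ht
  | of i x =>
    by_cases hi : i < n
    · refine ⟨Pi.single ⟨i, hi⟩ x, ?_⟩
      rw [LinearMap.sum_apply, Finset.sum_eq_single ⟨i, hi⟩]
      · simp [DirectSum.lof_eq_of]
      · intro j _ hj
        simp [Pi.single_eq_of_ne hj]
      · simp
    · rw [(BimodulePower.subsingleton_of_le hn (not_lt.1 hi)).elim x 0, map_zero]
      exact Submodule.zero_mem _

theorem isFiniteAlong_ofRing [Module.Finite Aᵐᵒᵖ M] {n : ℕ}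
    (hn : Subsingleton (BimodulePower A M n)) : IsFiniteAlong (ofRing A M).op :=
  have := finite_graded hn
  Module.Finite.equiv (gradedLinearEquiv A M)

theorem projective_opAsModule [Module.Finite Aᵐᵒᵖ M] [Module.Projective Aᵐᵒᵖ M] :
    Module.Projective Aᵐᵒᵖ (opAsModule A M) :=
  have := BimodulePower.projective (A := A) (M := M)
  Module.Projective.of_equiv (gradedLinearEquiv A M)

end Finiteness

/-! ### Projectivity of the augmentation ideal. -/

section Kernel

variable (f : M →ₗ[Aᵐᵒᵖ] A)

/-- Contraction of the first factors with a linear form. -/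
noncomputable def contract : Graded A M →+ Graded A M :=
  DirectSum.toAddMonoid fun
    | 0 => 0
    | i + 1 => (of _ i).comp (BimodulePower.contract f i).toAddMonoidHom

@[simp] theorem contract_of_zero (a : BimodulePower A M 0) : contract f (of _ 0 a) = 0 :=
  DirectSum.toAddMonoid_of _ _ _

@[simp] theorem contract_of_succ (i : ℕ) (x : BimodulePower A M (i + 1)) :
    contract f (of _ (i + 1) x) = of _ i (BimodulePower.contract f i x) :=
  DirectSum.toAddMonoid_of _ _ _

theorem contract_op_smul (a : Aᵐᵒᵖ) (s : Graded A M) :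
    contract f (a • s) = a • contract f s := by
  induction s using DirectSum.induction_on with
  | zero => simp
  | of i x => cases i <;> simp [op_smul_of]
  | add s t hs ht => rw [smul_add, map_add, map_add, hs, ht, smul_add]

/-- Positive degree is essential: the unit contracts to `0`, while its product with `m` contracts to
`f m`. -/
theorem contract_shiftRight (m : M) {s : Graded A M} (hs : s ∈ filtration 1) :
    contract f (shiftRight A m s) = shiftRight A m (contract f s) :=
  filtration_induction
    (p := fun s => contract f (shiftRight A m s) = shiftRight A m (contract f s)) hs (by simp)
    (fun i hi x => by
      obtain ⟨i, rfl⟩ := Nat.exists_eq_add_of_le' hi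
      rw [shiftRight_of, contract_of_succ, contract_of_succ, shiftRight_of]
      rfl)
    fun s t hs ht => by simp only [map_add, hs, ht]

/-- Contraction touches the first factor and multiplication the last. Staying in positive degree is
proved simultaneously, as the induction over products needs it. -/
theorem contract_act (t : TensorRing A M) {s : Graded A M} (hs : s ∈ filtration 1) :
    act t s ∈ filtration 1 ∧ contract f (act t s) = act t (contract f s) := by
  induction t using induction_on generalizing s with
  | ofRing a =>
    rw [act_ofRing, act_ofRing, contract_op_smul]
    refine ⟨fun i hi => ?_, rfl⟩
    change MulOpposite.op a • s i = 0
    rw [hs i hi, smul_zero]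
  | ofBimodule m =>
    rw [act_ofBimodule, act_ofBimodule, contract_shiftRight f m hs]
    exact ⟨fun i hi => shiftRight_mem_filtration hs m i (by omega), rfl⟩
  | add t t' h h' =>
    rw [act_add, act_add, map_add, (h hs).2, (h' hs).2]
    exact ⟨AddSubgroup.add_mem _ (h hs).1 (h' hs).1, rfl⟩
  | mul t t' h h' =>
    rw [act_mul, act_mul, (h' (h hs).1).2, (h hs).2]
    exact ⟨(h' (h hs).1).1, rfl⟩

variable {f}

/-- This is the dual basis identity of `M` applied to the first tensor factor. -/
theorem sum_ofBimodule_mul_ofPower {k : ℕ} {x : Fin k → M} {f : Fin k → M →ₗ[Aᵐᵒᵖ] A}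
    (h : ∀ y, ∑ j, MulOpposite.op (f j y) • x j = y) (i : ℕ) (y : BimodulePower A M (i + 1)) :
    ∑ j, ofBimodule A M (x j) * ofPower A M i (BimodulePower.contract (f j) i y) =
      ofPower A M (i + 1) y := by
  induction i with
  | zero =>
    induction y using BimodulePower.induction_on with
    | zero => simp
    | add s t hs ht => simp only [map_add, mul_add, Finset.sum_add_distrib, hs, ht]
    | tmul a m =>
      have : ∀ j, ofBimodule A M (x j) *
          ofPower A M 0 (BimodulePower.contract (f j) 0 (BimodulePower.tmul 0 a m)) =
          ofBimodule A M (MulOpposite.op (f j ((show A from a) • m)) • x j) := fun j =>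
        (ofBimodule_op_smul _ _).symm
      simp_rw [this]
      rw [← map_sum, h, ofPower_tmul]
      exact ofBimodule_smul _ _
  | succ i ih =>
    induction y using BimodulePower.induction_on with
    | zero => simp
    | add s t hs ht => simp only [map_add, mul_add, Finset.sum_add_distrib, hs, ht]
    | tmul y m =>
      rw [ofPower_tmul, ← ih y, Finset.sum_mul]
      refine Finset.sum_congr rfl fun j _ => ?_
      rw [mul_assoc, ← ofPower_tmul]
      rfl

theorem sum_ofBimodule_mul_contract {k : ℕ} {x : Fin k → M} {f : Fin k → M →ₗ[Aᵐᵒᵖ] A}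
    (h : ∀ y, ∑ j, MulOpposite.op (f j y) • x j = y) {s : Graded A M} (hs : s ∈ filtration 1) :
    ∑ j, ofBimodule A M (x j) * ofGraded A M (contract (f j) s) = ofGraded A M s :=
  filtration_induction (p := fun s => ∑ j, ofBimodule A M (x j) *
    ofGraded A M (contract (f j) s) = ofGraded A M s) hs (by simp)
    (fun i hi y => by
      obtain ⟨i, rfl⟩ := Nat.exists_eq_add_of_le' hi
      simp only [contract_of_succ, ofGraded_of]
      exact sum_ofBimodule_mul_ofPower h i y)
    fun s t hs ht => by simp only [map_add, mul_add, Finset.sum_add_distrib, hs, ht]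

/-- The ideal is `M ⊗ T`, so a dual basis `(x j, f j)` of `M` induces one of the ideal: the elements
`x j` with the contractions by `f j`, which are linear over the tensor ring. The ideal is thus a
summand of a free module of rank `k`. -/
theorem projective_ker_toRing [Module.Finite Aᵐᵒᵖ M] [Module.Projective Aᵐᵒᵖ M] :
    Module.Projective (TensorRing A M)ᵐᵒᵖ (RingHom.ker (toRing A M).op) := by
  obtain ⟨k, x, f, h⟩ := exists_dual_basis (A := A) (X := M)
  have hmem : ∀ t : RingHom.ker (toRing A M).op,
      (gradedEquiv A M).symm t.1.unop ∈ filtration 1 := fun t =>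
    gradedEquiv_symm_mem_filtration_one (congrArg MulOpposite.unop t.2)
  let s : RingHom.ker (toRing A M).op →ₗ[(TensorRing A M)ᵐᵒᵖ] (Fin k → (TensorRing A M)ᵐᵒᵖ) :=
    { toFun := fun t j =>
        MulOpposite.op (ofGraded A M (contract (f j) ((gradedEquiv A M).symm t.1.unop)))
      map_add' := fun t t' => by
        ext j
        simp
      map_smul' := fun t t' => by
        ext j
        refine MulOpposite.unop_injective ?_
        change ofGraded A M (contract (f j) (act (t'.1.unop * t.unop) _)) =
          ofGraded A M (contract (f j) ((gradedEquiv A M).symm t'.1.unop)) * t.unop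
        rw [act_mul, ← ofGraded_act, ← (contract_act (f j) t.unop (hmem t')).2]
        rfl }
  have hx : ∀ m, MulOpposite.op (ofBimodule A M m) ∈ RingHom.ker (toRing A M).op := fun m =>
    congrArg MulOpposite.op (toRing_ofBimodule m)
  let p : (Fin k → (TensorRing A M)ᵐᵒᵖ) →ₗ[(TensorRing A M)ᵐᵒᵖ] RingHom.ker (toRing A M).op :=
    Fintype.linearCombination _ fun j => ⟨_, hx (x j)⟩
  refine Module.Projective.of_split s p (LinearMap.ext fun t => Subtype.ext ?_)
  refine MulOpposite.unop_injective ?_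
  have := sum_ofBimodule_mul_contract h (hmem t)
  refine Eq.trans ?_ (this.trans ((gradedEquiv A M).apply_symm_apply t.1.unop))
  simp [p, s, Fintype.linearCombination_apply]

end Kernel

end TensorRing

/-! ### Finiteness over the central Noetherian ring and the main theorem. -/

section NoetherAlgebra

variable {R : Type w} [CommRing R] {A M : Type u} [Ring A] [Algebra R A] [Module.Finite R A]

variable (R A) in
theorem isNoetherianRing_op [IsNoetherianRing R] : IsNoetherianRing Aᵐᵒᵖ :=
  have : Module.Finite R Aᵐᵒᵖ := .equiv (MulOpposite.opLinearEquiv R)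
  .of_finite R Aᵐᵒᵖ

/-- Left finiteness descends to `R`. By centrality the right action induces the same `R`-structure,
so generators over `R` also generate on the right. -/
theorem finite_op_of_finite [AddCommGroup M] [Module A M] [Module Aᵐᵒᵖ M] [Module.Finite A M]
    (hM : ∀ (r : R) (x : M), algebraMap R A r • x = MulOpposite.op (algebraMap R A r) • x) :
    Module.Finite Aᵐᵒᵖ M := by
  let : Module R M := Module.compHom M (algebraMap R A)
  have hsmul : ∀ (r : R) (x : M), r • x = algebraMap R A r • x := fun _ _ => rfl
  have : IsScalarTower R A M := ⟨fun r a x => by rw [hsmul, Algebra.smul_def, mul_smul]⟩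
  have : IsScalarTower R Aᵐᵒᵖ M := ⟨fun r a x => by
    rw [hsmul, hM, ← mul_smul, Algebra.smul_def]
    rfl⟩
  have : Module.Finite R M := .trans A M
  exact .of_restrictScalars_finite R Aᵐᵒᵖ M

theorem IsFiniteAlong.isNoetherianRing {A B : Type u} [Ring A] [Ring B] {f : A →+* B}
    (hf : IsFiniteAlong f) [IsNoetherianRing A] : IsNoetherianRing B :=
  letI : Module A B := Module.compHom B f
  have : IsScalarTower A B B := ⟨fun a b c => mul_assoc (f a) b c⟩
  have : Module.Finite A B := hf
  .of_finite A B

end NoetherAlgebra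

theorem mainTheorem7 {R : Type w} [CommRing R] [IsNoetherianRing R]
    {Γ M : Type u} [Ring Γ] [Algebra R Γ] [Module.Finite R Γ]
    [AddCommGroup M] [Module Γ M] [Module Γᵐᵒᵖ M] [SMulCommClass Γ Γᵐᵒᵖ M]
    (hcentral : ∀ (r : R) (x : M),
      algebraMap R Γ r • x = MulOpposite.op (algebraMap R Γ r) • x)
    [Module.Finite Γ M]
    (n : ℕ) (hn : 1 ≤ n) (hnil : Subsingleton (BimodulePower Γ M n)) :
    ∃ (_ : IsNoetherianRing Γᵐᵒᵖ) (_ : IsNoetherianRing (TensorRing Γ M)ᵐᵒᵖ),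
      (Module.Projective Γ M → Module.Projective Γᵐᵒᵖ M →
        (ringIT Γ ≤ ringIT (TensorRing Γ M) ∧
          ringIT (TensorRing Γ M) ≤ n * (ringIT Γ + 1) - 1) ∧
        (ringExtDim Γ ≤ ringExtDim (TensorRing Γ M) ∧
          ringExtDim (TensorRing Γ M) ≤ n * (ringExtDim Γ + 1) - 1)) ∧
      (IsLeftPerfect Γ M →
        ringDerDim Γ ≤ ringDerDim (TensorRing Γ M) ∧
          ringDerDim (TensorRing Γ M) ≤ n * (ringDerDim Γ + 1) - 1) := by
  have hΓ : IsNoetherianRing Γᵐᵒᵖ := isNoetherianRing_op R Γ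
  have : Module.Finite Γᵐᵒᵖ M := finite_op_of_finite hcentral
  have hfin := TensorRing.isFiniteAlong_ofRing hnil
  have hT : IsNoetherianRing (TensorRing Γ M)ᵐᵒᵖ := hfin.isNoetherianRing
  have hsplit : (TensorRing.toRing Γ M).op.comp (TensorRing.ofRing Γ M).op = RingHom.id Γᵐᵒᵖ :=
    RingHom.ext fun a => MulOpposite.unop_injective (TensorRing.toRing_ofRing a.unop)
  obtain ⟨h₁, h₂, h₃⟩ :=
    dimensions_of_split_extension hsplit hfin hn (TensorRing.ker_toRing_pow hnil)
  exact ⟨hΓ, hT, fun _ _ => ⟨h₁ TensorRing.projective_opAsModule TensorRing.projective_ker_toRing,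
    h₂⟩, fun _ => h₃⟩
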